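/- Let $V=(A_1,A_2,H,\Phi,E,\sigma_1,\sigma_2,\gamma^{in},\gamma^{out})$ be a commutative two-operator vessel: $H$ is a complex Hilbert space, $E$ a finite-dimensional complex Hilbert space, $A_1,A_2$ are commuting bounded operators in $H$, $\Phi:H\to E$ is bounded, $\sigma_1,\sigma_2,\gamma^{in},\gamma^{out}$ are selfadjoint operators in $E$, and for $k=1,2$ $$\Phi^*\sigma_k\Phi=\tfrac1i(A_k-A_k^*),\qquad \gamma^{in}\Phi=\sigma_1\Phi A_2^*-\sigma_2\Phi A_1^*,\qquad \gamma^{out}\Phi=\sigma_1\Phi A_2-\sigma_2\Phi A_1,$$ $$\gamma^{out}=\gamma^{in}+i(\sigma_1\Phi\Phi^*\sigma_2-\sigma_2\Phi\Phi^*\sigma_1).$$ The discriminant polynomial of a vessel is $\Delta(y_1,y_2)=\det(y_1\sigma_2-y_2\sigma_1+\gamma^{in})$, and its discriminant variety is the zero set of $\Delta$ in $\mathbb C^2$. Assume that $\Delta$ is irreducible over $\mathbb C$ and let $C=\{\Delta=0\}$. Let $p_0,p_1,p_2$ be real polynomials in two variables such that $p_0(A_1,A_2)$ is invertible, and suppose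 that $r=(p_1/p_0,\,p_2/p_0)$ is a birational isomorphism of $C$ to an irreducible plane algebraic curve $C'\subset\mathbb C^2$, i.e. a rational mapping of $C$ into $C'$ (so $p_0\not\equiv0$ on $C$) that has an inverse rational mapping of $C'$ into $C$. Let $n$ be the maximal degree of $p_0,p_1,p_2$ and let $P_0,P_1,P_2$ be their homogenizations of degree $n$ in $x_0,x_1,x_2$. Let $W_n$ be the orthogonal direct sum of copies of $E$ indexed by the multi-indices $i=(i_0,i_1,i_2)$ with $|i|=n-1$, and let $$V_n=\{(w_i)\in W_n:\ \gamma^{in}w_{j+(1,0,0)}+\sigma_2w_{j+(0,1,0)}-\sigma_1w_{j+(0,0,1)}=0\ \text{ for all } |j|=n-2\}.$$ For $(P,Q)=(P_1,P_0),(P_2,P_0),(P_1,P_2)$ there exist real symmetric matrices $\beta^{10},\beta^{20},\beta^{12}$ indexed by $|i|=|j|=n-1$ with $$P(x)Q(y)-Q(x)P(y)=\sum_{i,j}x^i\bigl(\beta^{10}_{ij}(x_1y_0-x_0y_1)+\beta^{20}_{ij}(x_2y_0-x_0y_2)+\beta^{12}_{ij}(x_1y_2-x_2y_1)\bigr)y^j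 .$$ For any choice of such matrices, put $$B(P,Q)=\beta^{12}\otimes\gamma^{in}+\beta^{10}\otimes\sigma_1+\beta^{20}\otimes\sigma_2 \quad\text{on } W_n,$$ and let $B'(P,Q)=\mathcal P_{V_n}B(P,Q)|_{V_n}$, where $\mathcal P$ denotes orthogonal projection. Put $E'=V_n$ and $$A_k'=p_k(A_1,A_2)\,p_0(A_1,A_2)^{-1}\ (k=1,2),\qquad \Phi'=\mathcal P_{E'}\bigl(\Phi A_1^{*i_1}A_2^{*i_2}p_0(A_1^*,A_2^*)^{-1}\bigr)_{|i|=n-1},$$ $$\sigma_1'=B'(P_1,P_0),\quad \sigma_2'=B'(P_2,P_0),\quad \gamma'^{in}=B'(P_1,P_2),\quad \gamma'^{out}=\gamma'^{in}+i(\sigma_1'\Phi'\Phi'^*\sigma_2'-\sigma_2'\Phi'\Phi'^*\sigma_1').$$ Let $E''=\bar V_n\subseteq V_n$ be the orthogonal complement in $V_n$ of the span of all Vandermonde vectors $(x^ie)_{|i|=n-1}$ such that $[x_0:x_1:x_2]$ is a point of the complex projective plane with $P_0(x)=P_1(x)=P_2(x)=0$ and $e\in E$ satisfies $(x_0\gamma^{in}+x_1\sigma_2-x_2\sigma_1)e=0$.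 Put $\Phi''=\mathcal P_{E''}\Phi'$ and let $\sigma_1'',\sigma_2'',\gamma''^{in},\gamma''^{out}$ be the compressions $\mathcal P_{E''}T|_{E''}$ of $T=\sigma_1',\sigma_2',\gamma'^{in},\gamma'^{out}$ to $E''$. Then $$V''=(A_1',A_2',H,\Phi'',E'',\sigma_1'',\sigma_2'',\gamma''^{in},\gamma''^{out})$$ is a commutative vessel, and its discriminant variety contains $C'$. -/

import Mathlib

open MvPolynomial

noncomputable section

/-- The data `(A₁, A₂, H, Φ, E, σ₁, σ₂, γⁱⁿ, γᵒᵘᵗ)` of a two-operator vessel, without the vessel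
conditions (these are `VesselData.IsVessel`). -/
structure VesselData (H E : Type*)
    [NormedAddCommGroup H] [InnerProductSpace ℂ H]
    [NormedAddCommGroup E] [InnerProductSpace ℂ E] where
  A₁ : H →L[ℂ] H
  A₂ : H →L[ℂ] H
  Φ : H →L[ℂ] E
  σ₁ : E →L[ℂ] E
  σ₂ : E →L[ℂ] E
  γin : E →L[ℂ] E
  γout : E →L[ℂ] E

/-- The conditions for a commutative two-operator vessel. (For two operators the antisymmetric
families `γⁱⁿᵢⱼ`, `γᵒᵘᵗᵢⱼ` amount to the single operators `γⁱⁿ = γⁱⁿ₁₂`, `γᵒᵘᵗ = γᵒᵘᵗ₁₂`.) -/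
structure VesselData.IsVessel {H E : Type*}
    [NormedAddCommGroup H] [InnerProductSpace ℂ H] [CompleteSpace H]
    [NormedAddCommGroup E] [InnerProductSpace ℂ E] [CompleteSpace E]
    (V : VesselData H E) : Prop where
  comm : V.A₁ ∘L V.A₂ = V.A₂ ∘L V.A₁
  selfAdjoint_σ₁ : IsSelfAdjoint V.σ₁
  selfAdjoint_σ₂ : IsSelfAdjoint V.σ₂
  selfAdjoint_γin : IsSelfAdjoint V.γin
  selfAdjoint_γout : IsSelfAdjoint V.γout
  colligation₁ : V.Φ.adjoint ∘L V.σ₁ ∘L V.Φ = (1 / Complex.I) • (V.A₁ - V.A₁.adjoint)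
  colligation₂ : V.Φ.adjoint ∘L V.σ₂ ∘L V.Φ = (1 / Complex.I) • (V.A₂ - V.A₂.adjoint)
  input : V.γin ∘L V.Φ = V.σ₁ ∘L V.Φ ∘L V.A₂.adjoint - V.σ₂ ∘L V.Φ ∘L V.A₁.adjoint
  output : V.γout ∘L V.Φ = V.σ₁ ∘L V.Φ ∘L V.A₂ - V.σ₂ ∘L V.Φ ∘L V.A₁
  linkage : V.γout = V.γin + Complex.I •
    (V.σ₁ ∘L V.Φ ∘L V.Φ.adjoint ∘L V.σ₂ - V.σ₂ ∘L V.Φ ∘L V.Φ.adjoint ∘L V.σ₁)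

/-- The discriminant polynomial `Δ(y₁, y₂) = det (y₁ σ₂ - y₂ σ₁ + γⁱⁿ)`; `y₁ = X 0`, `y₂ = X 1`.
The determinant does not depend on the basis used to write it. -/
def VesselData.discriminantPolynomial {H E : Type*}
    [NormedAddCommGroup H] [InnerProductSpace ℂ H]
    [NormedAddCommGroup E] [InnerProductSpace ℂ E] [FiniteDimensional ℂ E]
    (V : VesselData H E) : MvPolynomial (Fin 2) ℂ :=
  let b := Module.finBasis ℂ E
  let M := fun T : E →L[ℂ] E =>
    (LinearMap.toMatrix b b (T : E →ₗ[ℂ] E)).map (C : ℂ → MvPolynomial (Fin 2) ℂ)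
  Matrix.det ((X 0 : MvPolynomial (Fin 2) ℂ) • M V.σ₂ - (X 1 : MvPolynomial (Fin 2) ℂ) • M V.σ₁
    + M V.γin)

/-- The affine plane curve `{f = 0}` in `ℂ²`. -/
def planeCurve (f : MvPolynomial (Fin 2) ℂ) : Set (Fin 2 → ℂ) := {y | eval y f = 0}

/-- The discriminant variety of a vessel: the zero set in `ℂ²` of its discriminant polynomial. -/
def VesselData.discriminantVariety {H E : Type*}
    [NormedAddCommGroup H] [InnerProductSpace ℂ H]
    [NormedAddCommGroup E] [InnerProductSpace ℂ E] [FiniteDimensional ℂ E]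
    (V : VesselData H E) : Set (Fin 2 → ℂ) := planeCurve V.discriminantPolynomial

/-- Pointwise description of the discriminant polynomial, showing that it is independent of the
basis in its definition. -/
theorem VesselData.eval_discriminantPolynomial {H E : Type*}
    [NormedAddCommGroup H] [InnerProductSpace ℂ H]
    [NormedAddCommGroup E] [InnerProductSpace ℂ E] [FiniteDimensional ℂ E]
    (V : VesselData H E) (y : Fin 2 → ℂ) :
    eval y V.discriminantPolynomial =
      LinearMap.det ((y 0 • V.σ₂ - y 1 • V.σ₁ + V.γin : E →L[ℂ] E) : E →ₗ[ℂ] E) := by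
  rw [← LinearMap.det_toMatrix (Module.finBasis ℂ E), VesselData.discriminantPolynomial,
    RingHom.map_det]
  congr 1
  ext i j
  simp [Matrix.map_apply]

/-- Compression of a collection to a subspace `K ⊆ E`: `Φ` becomes `P_K Φ`, and every operator
`T` in `E` becomes `P_K T P_K`, viewed as an operator in `K`. -/
def VesselData.compress {H E : Type*}
    [NormedAddCommGroup H] [InnerProductSpace ℂ H]
    [NormedAddCommGroup E] [InnerProductSpace ℂ E]
    (V : VesselData H E) (K : Submodule ℂ E) [K.HasOrthogonalProjection] : VesselData H K where
  A₁ := V.A₁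
  A₂ := V.A₂
  Φ := K.orthogonalProjectionOnto ∘L V.Φ
  σ₁ := K.orthogonalProjectionOnto ∘L V.σ₁ ∘L K.subtypeL
  σ₂ := K.orthogonalProjectionOnto ∘L V.σ₂ ∘L K.subtypeL
  γin := K.orthogonalProjectionOnto ∘L V.γin ∘L K.subtypeL
  γout := K.orthogonalProjectionOnto ∘L V.γout ∘L K.subtypeL

/-- A rational map of the plane, `y ↦ (num₁ y / den y, num₂ y / den y)`. -/
structure PlaneRationalMap where
  den : MvPolynomial (Fin 2) ℂ
  num₁ : MvPolynomial (Fin 2) ℂ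
  num₂ : MvPolynomial (Fin 2) ℂ

/-- The value of a rational map at a point (meaningful where `den` does not vanish). -/
def PlaneRationalMap.app (f : PlaneRationalMap) (y : Fin 2 → ℂ) : Fin 2 → ℂ :=
  ![eval y f.num₁ / eval y f.den, eval y f.num₂ / eval y f.den]

/-- `f` defines a rational mapping of the irreducible curve `S` into the curve `T`. -/
def PlaneRationalMap.MapsCurve (f : PlaneRationalMap) (S T : Set (Fin 2 → ℂ)) : Prop :=
  (∃ y ∈ S, eval y f.den ≠ 0) ∧ ∀ y ∈ S, eval y f.den ≠ 0 → f.app y ∈ T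

/-- `g ∘ f = id` as rational mappings of the irreducible curve `S` to itself: the composition is
defined somewhere on `S` (hence at all but finitely many of its points), and is the identity
wherever it is defined. -/
def PlaneRationalMap.LeftInverseOn (g f : PlaneRationalMap) (S : Set (Fin 2 → ℂ)) : Prop :=
  (∃ y ∈ S, eval y f.den ≠ 0 ∧ eval (f.app y) g.den ≠ 0) ∧
    ∀ y ∈ S, eval y f.den ≠ 0 → eval (f.app y) g.den ≠ 0 → g.app (f.app y) = y

/-- `f` is a birational isomorphism of the irreducible plane curve `S` to the irreducible plane
curve `T`: it has a rational inverse. -/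
def PlaneRationalMap.IsBirationalIso (f : PlaneRationalMap) (S T : Set (Fin 2 → ℂ)) : Prop :=
  f.MapsCurve S T ∧ ∃ g : PlaneRationalMap,
    g.MapsCurve T S ∧ g.LeftInverseOn f S ∧ f.LeftInverseOn g T

/-- The real rational transformation `r = (p₁ / p₀, p₂ / p₀)` as a map of the complex plane. -/
def realRationalMap (p : Fin 3 → MvPolynomial (Fin 2) ℝ) : PlaneRationalMap where
  den := map (algebraMap ℝ ℂ) (p 0)
  num₁ := map (algebraMap ℝ ℂ) (p 1)
  num₂ := map (algebraMap ℝ ℂ) (p 2)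

/-- The operator `p(A₁, A₂)`, for a real polynomial `p` and commuting operators `A₁`, `A₂`. -/
def polyOp {H : Type*} [NormedAddCommGroup H] [InnerProductSpace ℂ H]
    (p : MvPolynomial (Fin 2) ℝ) (A₁ A₂ : H →L[ℂ] H) : H →L[ℂ] H :=
  ∑ d ∈ p.support, ((p.coeff d : ℝ) : ℂ) • (A₁ ^ d 0 * A₂ ^ d 1)

/-- The largest of the degrees of `p₀, p₁, p₂`. -/
def maxDegree (p : Fin 3 → MvPolynomial (Fin 2) ℝ) : ℕ :=
  max (p 0).totalDegree (max (p 1).totalDegree (p 2).totalDegree)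

/-- Homogenization of `p(y₁, y₂)` up to degree `n ≥ deg p`, in the variables `x₀, x₁, x₂`. -/
def homogenizeTo (n : ℕ) (p : MvPolynomial (Fin 2) ℝ) : MvPolynomial (Fin 3) ℝ :=
  ∑ d ∈ p.support, C (p.coeff d) * (X 0 ^ (n - (d 0 + d 1)) * X 1 ^ d 0 * X 2 ^ d 1)

/-- Multi-indices `i = (i₀, i₁, i₂)` with `i₀ + i₁ + i₂ = n - 1` (there are none if `n = 0`). -/
abbrev MIdx (n : ℕ) : Type := {i : Fin 3 → ℕ // i 0 + i 1 + i 2 + 1 = n}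

instance (n : ℕ) : Finite (MIdx n) := by
  refine Finite.of_injective (β := Fin 3 → Fin n)
    (fun i k => ⟨i.1 k, by have := i.2; fin_cases k <;> simp <;> omega⟩) ?_
  intro i j h
  ext k
  simpa using congrArg Fin.val (congrFun h k)

instance (n : ℕ) : Fintype (MIdx n) := Fintype.ofFinite _

/-- The blown-up space `Wₙ`: families `(wᵢ)` of vectors of `E` indexed by `|i| = n - 1`, with the
Hilbert space structure of an orthogonal direct sum. -/
abbrev BlownSpace (n : ℕ) (E : Type*) : Type _ := PiLp 2 (fun _ : MIdx n => E)

/-- The principal subspace `Vₙ ⊆ Wₙ` of a vessel: for all `j` with `|j| = n - 2`,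
`γⁱⁿ w_{j + (1,0,0)} + σ₂ w_{j + (0,1,0)} - σ₁ w_{j + (0,0,1)} = 0`. -/
def VesselData.principalSubspace {H E : Type*}
    [NormedAddCommGroup H] [InnerProductSpace ℂ H]
    [NormedAddCommGroup E] [InnerProductSpace ℂ E]
    (V : VesselData H E) (n : ℕ) : Submodule ℂ (BlownSpace n E) where
  carrier := {w | ∀ (j : Fin 3 → ℕ) (a b c : MIdx n),
    a.1 = j + Pi.single 0 1 → b.1 = j + Pi.single 1 1 → c.1 = j + Pi.single 2 1 →
    V.γin (w a) + V.σ₂ (w b) - V.σ₁ (w c) = 0}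
  zero_mem' := by intro j a b c _ _ _; simp
  add_mem' := by
    intro u v hu hv j a b c ha hb hc
    have h1 := hu j a b c ha hb hc
    have h2 := hv j a b c ha hb hc
    calc V.γin ((u + v) a) + V.σ₂ ((u + v) b) - V.σ₁ ((u + v) c)
        = (V.γin (u a) + V.σ₂ (u b) - V.σ₁ (u c))
          + (V.γin (v a) + V.σ₂ (v b) - V.σ₁ (v c)) := by
          simp only [PiLp.add_apply, map_add]; abel
      _ = 0 := by rw [h1, h2, add_zero]
  smul_mem' := by
    intro t u hu j a b c ha hb hc
    have h1 := hu j a b c ha hb hc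
    calc V.γin ((t • u) a) + V.σ₂ ((t • u) b) - V.σ₁ ((t • u) c)
        = t • (V.γin (u a) + V.σ₂ (u b) - V.σ₁ (u c)) := by
          simp only [PiLp.smul_apply, map_smul, smul_add, smul_sub]
      _ = 0 := by rw [h1, smul_zero]

/-- The Vandermonde vector `(xⁱ e)_{|i| = n - 1}`, where `xⁱ = x₀^{i₀} x₁^{i₁} x₂^{i₂}`. -/
def vandermondeVector {E : Type*} [NormedAddCommGroup E] [InnerProductSpace ℂ E]
    (n : ℕ) (x : Fin 3 → ℂ) (e : E) : BlownSpace n E :=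
  WithLp.toLp 2 (fun i => (x 0 ^ i.1 0 * x 1 ^ i.1 1 * x 2 ^ i.1 2) • e)

/-- The operator `β ⊗ D` in `Wₙ`: `((β ⊗ D) w)ᵢ = ∑ⱼ βᵢⱼ D wⱼ`. -/
def blockOp {E : Type*} [NormedAddCommGroup E] [InnerProductSpace ℂ E] {n : ℕ}
    (β : Matrix (MIdx n) (MIdx n) ℝ) (D : E →L[ℂ] E) : BlownSpace n E →L[ℂ] BlownSpace n E :=
  ((PiLp.continuousLinearEquiv 2 ℂ (fun _ : MIdx n => E)).symm : (MIdx n → E) →L[ℂ] _) ∘L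
    ContinuousLinearMap.pi (fun i => ∑ j, ((β i j : ℝ) : ℂ) • (D ∘L PiLp.proj 2 _ j))

/-- The monomial `xⁱ = x₀^{i₀} x₁^{i₁} x₂^{i₂}` in the polynomial ring in two triples of variables
`x = X (Sum.inl ·)`, `y = X (Sum.inr ·)`. -/
def xMonomial {n : ℕ} (i : MIdx n) : MvPolynomial (Fin 3 ⊕ Fin 3) ℝ :=
  X (Sum.inl 0) ^ i.1 0 * X (Sum.inl 1) ^ i.1 1 * X (Sum.inl 2) ^ i.1 2

/-- The monomial `yⁱ`. -/
def yMonomial {n : ℕ} (i : MIdx n) : MvPolynomial (Fin 3 ⊕ Fin 3) ℝ :=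
  X (Sum.inr 0) ^ i.1 0 * X (Sum.inr 1) ^ i.1 1 * X (Sum.inr 2) ^ i.1 2

/-- The polynomial `x_k y_l - x_l y_k`. -/
def xyMinor (k l : Fin 3) : MvPolynomial (Fin 3 ⊕ Fin 3) ℝ :=
  X (Sum.inl k) * X (Sum.inr l) - X (Sum.inl l) * X (Sum.inr k)

/-- A triple of symmetric matrices `β¹⁰, β²⁰, β¹²` with `P(x) Q(y) - Q(x) P(y) =
∑ xⁱ (β¹⁰ᵢⱼ (x₁ y₀ - x₀ y₁) + β²⁰ᵢⱼ (x₂ y₀ - x₀ y₂) + β¹²ᵢⱼ (x₁ y₂ - x₂ y₁)) yʲ`,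
the sum being over `|i| = |j| = n - 1`. -/
structure BezoutTriple (n : ℕ) (P Q : MvPolynomial (Fin 3) ℝ) where
  β10 : Matrix (MIdx n) (MIdx n) ℝ
  β20 : Matrix (MIdx n) (MIdx n) ℝ
  β12 : Matrix (MIdx n) (MIdx n) ℝ
  symm10 : β10.IsSymm
  symm20 : β20.IsSymm
  symm12 : β12.IsSymm
  identity : rename Sum.inl P * rename Sum.inr Q - rename Sum.inl Q * rename Sum.inr P =
    ∑ i, ∑ j, xMonomial i *
      (C (β10 i j) * xyMinor 1 0 + C (β20 i j) * xyMinor 2 0 + C (β12 i j) * xyMinor 1 2) *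
      yMonomial j

/-- The formal Bezout operator `B(P, Q) = β¹² ⊗ γⁱⁿ + β¹⁰ ⊗ σ₁ + β²⁰ ⊗ σ₂` in `Wₙ`. -/
def VesselData.blownBezout {H E : Type*}
    [NormedAddCommGroup H] [InnerProductSpace ℂ H]
    [NormedAddCommGroup E] [InnerProductSpace ℂ E]
    (V : VesselData H E) {n : ℕ} {P Q : MvPolynomial (Fin 3) ℝ} (β : BezoutTriple n P Q) :
    BlownSpace n E →L[ℂ] BlownSpace n E :=
  blockOp β.β12 V.γin + blockOp β.β10 V.σ₁ + blockOp β.β20 V.σ₂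

/-- The Bezout operator `B'(P, Q)` along the discriminant curve: the compression of `B(P, Q)` to
the principal subspace `Vₙ`. -/
def VesselData.bezout {H E : Type*}
    [NormedAddCommGroup H] [InnerProductSpace ℂ H]
    [NormedAddCommGroup E] [InnerProductSpace ℂ E] [FiniteDimensional ℂ E]
    (V : VesselData H E) {n : ℕ} {P Q : MvPolynomial (Fin 3) ℝ} (β : BezoutTriple n P Q) :
    V.principalSubspace n →L[ℂ] V.principalSubspace n :=
  (V.principalSubspace n).orthogonalProjectionOnto ∘L V.blownBezout β ∘L
    (V.principalSubspace n).subtypeL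

/-- A choice of the matrices that define the Bezout operators used for the rational transformation
`(p₁ / p₀, p₂ / p₀)`. -/
structure BezoutChoice (p : Fin 3 → MvPolynomial (Fin 2) ℝ) where
  pair10 : BezoutTriple (maxDegree p)
    (homogenizeTo (maxDegree p) (p 1)) (homogenizeTo (maxDegree p) (p 0))
  pair20 : BezoutTriple (maxDegree p)
    (homogenizeTo (maxDegree p) (p 2)) (homogenizeTo (maxDegree p) (p 0))
  pair12 : BezoutTriple (maxDegree p)
    (homogenizeTo (maxDegree p) (p 1)) (homogenizeTo (maxDegree p) (p 2))

/-- The space `E' = Vₙ`. -/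
abbrev VesselData.transformSpace {H E : Type*}
    [NormedAddCommGroup H] [InnerProductSpace ℂ H]
    [NormedAddCommGroup E] [InnerProductSpace ℂ E]
    (V : VesselData H E) (p : Fin 3 → MvPolynomial (Fin 2) ℝ) :
    Submodule ℂ (BlownSpace (maxDegree p) E) :=
  V.principalSubspace (maxDegree p)

/-- The mapping `Φ' = P_{E'} (Φ A₁*^{i₁} A₂*^{i₂} p₀(A₁*, A₂*)⁻¹)ᵢ : H → E'`. -/
def VesselData.transformΦ {H E : Type*}
    [NormedAddCommGroup H] [InnerProductSpace ℂ H] [CompleteSpace H]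
    [NormedAddCommGroup E] [InnerProductSpace ℂ E] [FiniteDimensional ℂ E]
    (V : VesselData H E) (p : Fin 3 → MvPolynomial (Fin 2) ℝ) :
    H →L[ℂ] V.transformSpace p :=
  (V.transformSpace p).orthogonalProjectionOnto ∘L
    ((PiLp.continuousLinearEquiv 2 ℂ (fun _ : MIdx (maxDegree p) => E)).symm :
      (MIdx (maxDegree p) → E) →L[ℂ] _) ∘L
    ContinuousLinearMap.pi (fun i => V.Φ ∘L (V.A₁.adjoint ^ i.1 1) ∘L (V.A₂.adjoint ^ i.1 2) ∘L
      Ring.inverse (polyOp (p 0) V.A₁.adjoint V.A₂.adjoint))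

/-- The transformed collection `V' = (A'₁, A'₂, H, Φ', E', σ'₁, σ'₂, γ'ⁱⁿ, γ'ᵒᵘᵗ)`. -/
def VesselData.transform {H E : Type*}
    [NormedAddCommGroup H] [InnerProductSpace ℂ H] [CompleteSpace H]
    [NormedAddCommGroup E] [InnerProductSpace ℂ E] [FiniteDimensional ℂ E]
    (V : VesselData H E) (p : Fin 3 → MvPolynomial (Fin 2) ℝ) (β : BezoutChoice p) :
    VesselData H (V.transformSpace p) where
  A₁ := polyOp (p 1) V.A₁ V.A₂ * Ring.inverse (polyOp (p 0) V.A₁ V.A₂)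
  A₂ := polyOp (p 2) V.A₁ V.A₂ * Ring.inverse (polyOp (p 0) V.A₁ V.A₂)
  Φ := V.transformΦ p
  σ₁ := V.bezout β.pair10
  σ₂ := V.bezout β.pair20
  γin := V.bezout β.pair12
  γout := V.bezout β.pair12 + Complex.I •
    (V.bezout β.pair10 ∘L V.transformΦ p ∘L (V.transformΦ p).adjoint ∘L V.bezout β.pair20 -
      V.bezout β.pair20 ∘L V.transformΦ p ∘L (V.transformΦ p).adjoint ∘L V.bezout β.pair10)

/-- The span, inside `E' = Vₙ`, of the Vandermonde vectors `Vₙ(x, e)` at the basepoints `x` of the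
transformation on the discriminant curve: `[x₀ : x₁ : x₂]` in the projective plane is a common zero
of `P₀, P₁, P₂`, and `e` is in the kernel of `x₀ γⁱⁿ + x₁ σ₂ - x₂ σ₁`. -/
def VesselData.basepointSpan {H E : Type*}
    [NormedAddCommGroup H] [InnerProductSpace ℂ H]
    [NormedAddCommGroup E] [InnerProductSpace ℂ E]
    (V : VesselData H E) (p : Fin 3 → MvPolynomial (Fin 2) ℝ) :
    Submodule ℂ (V.transformSpace p) :=
  Submodule.span ℂ {v | ∃ (x : Fin 3 → ℂ) (e : E), x ≠ 0 ∧
    (∀ k, aeval x (homogenizeTo (maxDegree p) (p k)) = 0) ∧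
    x 0 • V.γin e + x 1 • V.σ₂ e - x 2 • V.σ₁ e = 0 ∧
    (v : BlownSpace (maxDegree p) E) = vandermondeVector (maxDegree p) x e}

/-- The subspace `E'' = V̄ₙ` of `E' = Vₙ`, orthogonal to the Vandermonde vectors at the
basepoints. -/
abbrev VesselData.reducedSpace {H E : Type*}
    [NormedAddCommGroup H] [InnerProductSpace ℂ H]
    [NormedAddCommGroup E] [InnerProductSpace ℂ E]
    (V : VesselData H E) (p : Fin 3 → MvPolynomial (Fin 2) ℝ) :
    Submodule ℂ (V.transformSpace p) :=
  (V.basepointSpan p)ᗮ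

/-- The compressed collection `V''`, the compression of `V'` to `E''`. -/
def VesselData.reducedTransform {H E : Type*}
    [NormedAddCommGroup H] [InnerProductSpace ℂ H] [CompleteSpace H]
    [NormedAddCommGroup E] [InnerProductSpace ℂ E] [FiniteDimensional ℂ E]
    (V : VesselData H E) (p : Fin 3 → MvPolynomial (Fin 2) ℝ) (β : BezoutChoice p) :
    VesselData H (V.reducedSpace p) :=
  (V.transform p β).compress (V.reducedSpace p)

end

/-! Write `s = (γⁱⁿ, σ₂, -σ₁)` for the coefficients of the pencil. The Bezout form is a combination
of the entries of a cross product `x × y`, and `B(P, Q)` arises by putting `s₀, s₁, s₂` in place of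
these entries. The relations among the entries of `Y × x` are generated by `x` and `Y`
(`exists_of_cross_eq_zero`). On a family `(τ (xⁱ))ᵢ` with `∑ s_l τ (x_l r) = 0` the relation `x`
acts as zero; paired with a vector of `Vₙ`, so does the relation `Y`. Hence a combination of Bezout
forms that vanishes identically in `Y` kills such families modulo the complement of `Vₙ`. This is
used twice: over real polynomials with `τ r = Φ r(A₁*, A₂*) h`, and over `ℂ` with `τ r = r e`, where
the family is a Vandermonde vector.

Vessel conditions. `Φ* s Φ` is `1/i` times the cross product of `(1, A₁, A₂)` and `(1, A₁*, A₂*)`,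
so the Bezout identity at these operators gives the colligation conditions. The identity `P₀ B'(P₁,
P₂) + P₁ B'(P₂, P₀) - P₂ B'(P₁, P₀) = 0` on blown-up orbits gives the input condition, and the
output condition follows by linkage. All Bezout operators vanish on the Vandermonde vectors at
basepoints, so compression to `E''` loses nothing.

Curve. Let `y` lie on `C` with `p₀(y) ≠ 0`, and let `e` be in the kernel of the pencil `M(y)`. The
same three-term identity puts the projection to `E''` of the Vandermonde vector of `(y, e)` in the
kernel of the new pencil at `r(y)`. So `r(y)` is in the new variety unless all these projections
vanish. If they do, pairing with Vandermonde vectors at the points `z` that `r` separates from `y`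
shows that `adj M(z) s_l e = 0` for almost all `z` on `C`, hence also for `z = y`. The columns of
`adj M(y)` are such vectors `e`, so `adj M(y) s_l adj M(y) = 0`, and Jacobi's formula makes the
gradient of `Δ` vanish at `y` (`eval_pderiv_eq_zero`). Thus `r(y)` is in the new variety for every
generic smooth `y`, and irreducibility of `Δ` and of the equation of `C'` extends this to all of
`C'`. -/

/-! ### Syzygies of a cross product. -/

/-- The substitution `Y_l ↦ Y_l + a_l Y_k` (`l ≠ k`), `Y_k ↦ Y_k`. -/
noncomputable def shear {R : Type*} [CommRing R] (k : Fin 3) (a : Fin 3 → R) :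
    MvPolynomial (Fin 3) R →ₐ[R] MvPolynomial (Fin 3) R :=
  aeval (fun l => if l = k then X k else X l + C (a l) * X k)

theorem shear_X_self {R : Type*} [CommRing R] (k : Fin 3) (a : Fin 3 → R) :
    shear k a (X k) = X k := by simp [shear]

theorem shear_X_of_ne {R : Type*} [CommRing R] {k l : Fin 3} (a : Fin 3 → R) (h : l ≠ k) :
    shear k a (X l) = X l + C (a l) * X k := by simp [shear, h]

theorem shear_C {R : Type*} [CommRing R] (k : Fin 3) (a : Fin 3 → R) (r : R) :
    shear k a (C r) = C r := by simp [shear]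

theorem shear_shear {R : Type*} [CommRing R] (k : Fin 3) (a : Fin 3 → R)
    (f : MvPolynomial (Fin 3) R) : shear k (-a) (shear k a f) = f := by
  have : (shear k (-a)).comp (shear k a) = AlgHom.id R _ := by
    ext l : 1
    by_cases h : l = k
    · subst h; simp [shear_X_self]
    · simp [shear_X_of_ne, shear_X_self, h]
  exact DFunLike.congr_fun this f

/-- Syzygies of two independent coordinates, in a polynomial ring. -/
theorem exists_of_mul_X_eq_mul_X {R : Type*} [CommRing R] [IsDomain R] {a b : Fin 3} (hab : a ≠ b)
    {f g : MvPolynomial (Fin 3) R} (h : f * X b = g * X a) :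
    ∃ c, f = c * X a ∧ g = c * X b := by
  have h1 : (X a : MvPolynomial (Fin 3) R) ∣ f * X b := ⟨g, by rw [h, mul_comm]⟩
  have h2 : (X a : MvPolynomial (Fin 3) R) ∣ f := by
    rcases X_dvd_mul_iff.mp h1 with h | h
    · exact h
    · exact absurd (X_dvd_X.mp h) hab
  obtain ⟨c, rfl⟩ := h2
  refine ⟨c, mul_comm _ _, ?_⟩
  have : g * X a = (c * X b) * X a := by rw [← h]; ring
  exact (isRegular_X (n := a)).right this

/-- The syzygies of the entries of the cross product `x × Y` of a constant vector `x`, one of whose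
entries is `1`, and the vector `Y` of variables. -/
theorem exists_of_cross_eq_zero {R : Type*} [CommRing R] [IsDomain R] (x : Fin 3 → R) (k : Fin 3)
    (hk : x k = 1) (q : Fin 3 → MvPolynomial (Fin 3) R)
    (hq : ∑ l, q l * (X (l + 1) * C (x (l + 2)) - X (l + 2) * C (x (l + 1))) = 0) :
    ∃ α c : MvPolynomial (Fin 3) R, ∀ l, q l = α * C (x l) + c * X l := by
  -- Since `x · (Y × x) = 0` and `x k = 1`, entry `k` of the cross product is a combination of the
  -- other two; eliminating it leaves a relation with coefficients `f` and `g`.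
  set f := q (k + 1) - q k * C (x (k + 1)) with hf
  set g := q (k + 2) - q k * C (x (k + 2)) with hg
  have e1 : k + 1 + 1 = k + 2 := by fin_cases k <;> rfl
  have e2 : k + 1 + 2 = k := by fin_cases k <;> rfl
  have e3 : k + 2 + 1 = k := by fin_cases k <;> rfl
  have e4 : k + 2 + 2 = k + 1 := by fin_cases k <;> rfl
  have n1 : k + 1 ≠ k := by fin_cases k <;> decide
  have n2 : k + 2 ≠ k := by fin_cases k <;> decide
  have n3 : k + 1 ≠ k + 2 := by fin_cases k <;> decide
  have hsum : ∀ F : Fin 3 → MvPolynomial (Fin 3) R, ∑ l, F l = F k + F (k + 1) + F (k + 2) := by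
    intro F
    fin_cases k <;> simp [Fin.sum_univ_three] <;> ring
  rw [hsum, e1, e2, e3, e4, hk] at hq
  have key : f * (X (k + 2) - C (x (k + 2)) * X k) = g * (X (k + 1) - C (x (k + 1)) * X k) := by
    rw [hf, hg]
    simp only [map_one, mul_one] at hq
    linear_combination hq
  -- The shear turns the linear forms `X l - x_l X k` into coordinates.
  have key2 := congrArg (shear k x) key
  simp only [map_mul, map_sub, shear_X_self, shear_X_of_ne x n1, shear_X_of_ne x n2, shear_C,
    add_sub_cancel_right] at key2
  obtain ⟨c, h1, h2⟩ := exists_of_mul_X_eq_mul_X n3 key2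
  have h1' := congrArg (shear k (-x)) h1
  have h2' := congrArg (shear k (-x)) h2
  rw [shear_shear, map_mul, shear_X_of_ne _ n1] at h1'
  rw [shear_shear, map_mul, shear_X_of_ne _ n2] at h2'
  set d := shear k (-x) c
  simp only [Pi.neg_apply, map_neg] at h1' h2'
  -- Entry `k`, where `x k = 1`, forces this value of `α`.
  refine ⟨q k - d * X k, d, ?_⟩
  have hcases : ∀ k l : Fin 3, l = k ∨ l = k + 1 ∨ l = k + 2 := by decide
  intro l
  rcases hcases k l with rfl | rfl | rfl
  · rw [hk]; simp
  · linear_combination h1'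
  · linear_combination h2'

/-- The exponent `i` as a finitely supported function. -/
noncomputable def MIdx.toFinsupp {n : ℕ} (i : MIdx n) : Fin 3 →₀ ℕ := Finsupp.equivFunOnFinite.symm i.1

theorem MIdx.toFinsupp_apply {n : ℕ} (i : MIdx n) (k : Fin 3) : i.toFinsupp k = i.1 k := rfl

theorem MIdx.toFinsupp_injective {n : ℕ} :
    Function.Injective (MIdx.toFinsupp : MIdx n → Fin 3 →₀ ℕ) := fun _ _ h =>
  Subtype.ext (Finsupp.equivFunOnFinite.symm.injective h)

/-- Linear functionals `λ i k` on coefficients that vanish on multiples of `x` and of `Y` vanish on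
every syzygy of `x × Y`. -/
theorem sum_pairing_eq_zero {R A : Type*} [CommRing R] [IsDomain R] [AddCommGroup A] {n : ℕ}
    (x : Fin 3 → R) (k : Fin 3) (hk : x k = 1) (q : Fin 3 → MIdx n → R)
    (hq : ∑ i, monomial i.toFinsupp 1 * ∑ l, C (q l i) *
      (X (l + 1) * C (x (l + 2)) - X (l + 2) * C (x (l + 1))) = (0 : MvPolynomial (Fin 3) R))
    (L : MIdx n → Fin 3 → R →+ A)
    (hx : ∀ i r, ∑ l, L i l (x l * r) = 0)
    (hY : ∀ (j : Fin 3 → ℕ) (a b c : MIdx n), a.1 = j + Pi.single 0 1 → b.1 = j + Pi.single 1 1 →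
      c.1 = j + Pi.single 2 1 → ∀ r, L a 0 r + L b 1 r + L c 2 r = 0) :
    ∑ i, ∑ l, L i l (q l i) = 0 := by
  obtain ⟨α, c, h⟩ := exists_of_cross_eq_zero x k hk
    (fun l => ∑ i, monomial i.toFinsupp (q l i)) (by
      rw [← hq]
      simp only [Finset.sum_mul, Finset.mul_sum]
      rw [Finset.sum_comm]
      refine Finset.sum_congr rfl fun i _ => Finset.sum_congr rfl fun l _ => ?_
      rw [← mul_assoc, mul_comm (monomial _ _) (C _), C_mul_monomial, mul_one])
  have hcoeff : ∀ i l, q l i = x l * coeff i.toFinsupp α + coeff i.toFinsupp (c * X l) := by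
    intro i l
    have := congrArg (coeff i.toFinsupp) (h l)
    rw [coeff_add, mul_comm α, coeff_C_mul, coeff_sum] at this
    rw [← this, Finset.sum_eq_single i]
    · simp
    · intro j _ hj
      rw [coeff_monomial, if_neg]
      exact fun e => hj (MIdx.toFinsupp_injective e)
    · simp
  have hc : ∀ c : MvPolynomial (Fin 3) R,
      ∑ i : MIdx n, ∑ l, L i l (coeff i.toFinsupp (c * X l)) = 0 := by
    intro c
    induction c using MvPolynomial.induction_on' with
    | add p q hp hq =>
      simp only [add_mul, coeff_add, map_add, Finset.sum_add_distrib, hp, hq, add_zero]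
    | monomial d r =>
      -- The exponents `d + e_l` are indices in `MIdx n` exactly when `|d| = n - 2`; then the sum is
      -- the relation `hY` for `j = d`. In other degrees every coefficient is zero.
      by_cases hd : d 0 + d 1 + d 2 + 2 = n
      · have hidx : ∀ l, (fun m => d m + (Pi.single l 1 : Fin 3 → ℕ) m) 0 +
            (fun m => d m + (Pi.single l 1 : Fin 3 → ℕ) m) 1 +
            (fun m => d m + (Pi.single l 1 : Fin 3 → ℕ) m) 2 + 1 = n := by
          intro l; fin_cases l <;> simp <;> omega
        let a : Fin 3 → MIdx n := fun l => ⟨fun m => d m + (Pi.single l 1 : Fin 3 → ℕ) m, hidx l⟩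
        rw [Finset.sum_comm]
        have : ∀ l, ∑ i : MIdx n, L i l (coeff i.toFinsupp (monomial d r * X l)) = L (a l) l r := by
          intro l
          have ha : (a l).toFinsupp = d + Finsupp.single l 1 := by
            ext m; simp [MIdx.toFinsupp_apply, a, Finsupp.single_apply, Pi.single_apply, eq_comm]
          rw [Finset.sum_eq_single (a l)]
          · rw [ha, coeff_mul_X]; simp
          · intro i _ hi
            rw [X, monomial_mul, coeff_monomial, if_neg, map_zero]
            rw [← ha]
            exact fun e => hi (MIdx.toFinsupp_injective e).symm
          · simp
        simp only [this, Fin.sum_univ_three]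
        exact hY d (a 0) (a 1) (a 2) rfl rfl rfl r
      · refine Finset.sum_eq_zero fun i _ => Finset.sum_eq_zero fun l _ => ?_
        rw [X, monomial_mul, coeff_monomial, if_neg, map_zero]
        intro e
        apply hd
        have hi := i.2
        have e0 := DFunLike.congr_fun e 0
        have e1 := DFunLike.congr_fun e 1
        have e2 := DFunLike.congr_fun e 2
        simp only [MIdx.toFinsupp_apply] at e0 e1 e2
        rw [← e0, ← e1, ← e2] at hi
        rw [← hi]
        fin_cases l <;> simp <;> omega
  simp only [hcoeff, map_add, Finset.sum_add_distrib, hc, add_zero]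
  refine Finset.sum_eq_zero fun i _ => ?_
  exact hx i (coeff i.toFinsupp α)

/-! ### The Bezout identity in cross product form. -/

/-- The coefficients `(γⁱⁿ, σ₂, -σ₁)` of the pencil `x₀ γⁱⁿ + x₁ σ₂ - x₂ σ₁`. -/
def VesselData.pencil {H E : Type*}
    [NormedAddCommGroup H] [InnerProductSpace ℂ H]
    [NormedAddCommGroup E] [InnerProductSpace ℂ E]
    (V : VesselData H E) : Fin 3 → E →L[ℂ] E := ![V.γin, V.σ₂, -V.σ₁]

/-- The coefficients `(β¹², β²⁰, -β¹⁰)` of the entries of the cross product `x × y`. -/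
def BezoutTriple.coef {n : ℕ} {P Q : MvPolynomial (Fin 3) ℝ} (β : BezoutTriple n P Q) :
    Fin 3 → Matrix (MIdx n) (MIdx n) ℝ := ![β.β12, β.β20, -β.β10]

theorem BezoutTriple.coef_symm {n : ℕ} {P Q : MvPolynomial (Fin 3) ℝ} (β : BezoutTriple n P Q)
    (k : Fin 3) (i j : MIdx n) : β.coef k i j = β.coef k j i := by
  fin_cases k
  · exact (β.symm12.apply i j).symm
  · exact (β.symm20.apply i j).symm
  · exact congrArg Neg.neg (β.symm10.apply i j).symm

/-- The monomial `x^i`. -/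
def MIdx.mono {S : Type*} [Monoid S] {n : ℕ} (x : Fin 3 → S) (i : MIdx n) : S :=
  x 0 ^ i.1 0 * x 1 ^ i.1 1 * x 2 ^ i.1 2

theorem MIdx.mono_X {R : Type*} [CommSemiring R] {n : ℕ} (i : MIdx n) :
    i.mono (X : Fin 3 → MvPolynomial (Fin 3) R) = monomial i.toFinsupp 1 := by
  rw [monomial_eq, map_one, one_mul, Finsupp.prod_fintype _ _ (by simp), Fin.prod_univ_three]
  rfl

/-- The Bezout identity, evaluated in a commutative algebra. -/
theorem BezoutTriple.aeval_identity {n : ℕ} {P Q : MvPolynomial (Fin 3) ℝ}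
    (β : BezoutTriple n P Q) {S : Type*} [CommRing S] [Algebra ℝ S] (x y : Fin 3 → S) :
    aeval x P * aeval y Q - aeval x Q * aeval y P =
      ∑ i : MIdx n, ∑ j : MIdx n, i.mono x *
        (∑ k, algebraMap ℝ S (β.coef k i j) * (x (k + 1) * y (k + 2) - x (k + 2) * y (k + 1))) *
        j.mono y := by
  have h := congrArg (aeval (Sum.elim x y)) β.identity
  simp only [map_sub, map_mul, aeval_rename, Sum.elim_comp_inl, Sum.elim_comp_inr, map_sum,
    map_add, xMonomial, yMonomial, xyMinor, map_pow, aeval_X, Sum.elim_inl, Sum.elim_inr,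
    aeval_C] at h
  rw [h]
  refine Finset.sum_congr rfl fun i _ => Finset.sum_congr rfl fun j _ => ?_
  have e : ∀ F : Fin 3 → S, ∑ k, F k = F 0 + F 1 + F 2 := fun F => Fin.sum_univ_three F
  rw [e]
  have h1 : (1 : Fin 3) + 1 = 2 := rfl
  have h2 : (1 : Fin 3) + 2 = 0 := rfl
  have h3 : (2 : Fin 3) + 1 = 0 := rfl
  have h4 : (2 : Fin 3) + 2 = 1 := rfl
  simp only [h1, h2, h3, h4, zero_add, MIdx.mono, coef, Matrix.cons_val_zero, Matrix.cons_val_one,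
    Matrix.cons_val, Matrix.neg_apply, map_neg]
  ring

/-- The coefficients of the Bezout form with the second argument frozen at `x`. -/
noncomputable def BezoutTriple.freeze {n : ℕ} {P Q : MvPolynomial (Fin 3) ℝ}
    (β : BezoutTriple n P Q) {S : Type*} [CommRing S] [Algebra ℝ S] (x : Fin 3 → S)
    (k : Fin 3) (i : MIdx n) : S := ∑ j : MIdx n, β.coef k i j • j.mono x

/-- With one argument fixed, the Bezout form is linear in the entries of `Y × x` with coefficients
in `S[Y]`, so whenever the right side cancels, the frozen coefficients form a syzygy. -/
theorem BezoutTriple.freeze_identity {n : ℕ} {P Q : MvPolynomial (Fin 3) ℝ}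
    (β : BezoutTriple n P Q) {S : Type*} [CommRing S] [Algebra ℝ S] (x : Fin 3 → S) :
    ∑ i : MIdx n, monomial i.toFinsupp 1 * ∑ l, C (β.freeze x l i) *
      (X (l + 1) * C (x (l + 2)) - X (l + 2) * C (x (l + 1))) =
    aeval (X : Fin 3 → MvPolynomial (Fin 3) S) P * C (aeval x Q) -
      aeval (X : Fin 3 → MvPolynomial (Fin 3) S) Q * C (aeval x P) := by
  have hC : ∀ F : MvPolynomial (Fin 3) ℝ,
      aeval (fun k => (C (x k) : MvPolynomial (Fin 3) S)) F = C (aeval x F) := fun F =>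
    aeval_algebraMap_apply (MvPolynomial (Fin 3) S) x F
  rw [← hC P, ← hC Q, β.aeval_identity X (fun k => C (x k))]
  refine Finset.sum_congr rfl fun i _ => ?_
  rw [MIdx.mono_X]
  simp only [freeze, map_sum, Finset.sum_mul, Finset.mul_sum]
  rw [Finset.sum_comm]
  refine Finset.sum_congr rfl fun j _ => Finset.sum_congr rfl fun l _ => ?_
  have : (C (β.coef l i j • j.mono x) : MvPolynomial (Fin 3) S) =
      algebraMap ℝ _ (β.coef l i j) * j.mono (fun k => (C (x k) : MvPolynomial (Fin 3) S)) := by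
    rw [Algebra.smul_def, map_mul, MIdx.mono, MIdx.mono]
    simp only [map_mul, map_pow]
    rfl
  rw [this]
  ring

/-! ### Bezout operators paired with the principal subspace. -/

section Pencil

variable {H E : Type*} [NormedAddCommGroup H] [InnerProductSpace ℂ H]
  [NormedAddCommGroup E] [InnerProductSpace ℂ E]

theorem blockOp_apply {n : ℕ} (b : Matrix (MIdx n) (MIdx n) ℝ) (D : E →L[ℂ] E)
    (w : BlownSpace n E) (i : MIdx n) : blockOp b D w i = ∑ j, b i j • D (w j) := by
  simp [blockOp]

theorem VesselData.blownBezout_apply (V : VesselData H E) {n : ℕ} {P Q : MvPolynomial (Fin 3) ℝ}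
    (β : BezoutTriple n P Q) (w : BlownSpace n E) (i : MIdx n) :
    V.blownBezout β w i = ∑ j, ∑ k, β.coef k i j • V.pencil k (w j) := by
  simp only [blownBezout, add_apply, PiLp.add_apply, blockOp_apply,
    ← Finset.sum_add_distrib, Fin.sum_univ_three, BezoutTriple.coef, VesselData.pencil,
    Matrix.cons_val_zero, Matrix.cons_val_one, Matrix.cons_val, Matrix.neg_apply,
    neg_apply, neg_smul, smul_neg, neg_neg]
  refine Finset.sum_congr rfl fun j _ => ?_
  abel

theorem VesselData.pencil_symm [CompleteSpace E] (V : VesselData H E)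
    (h1 : IsSelfAdjoint V.σ₁) (h2 : IsSelfAdjoint V.σ₂) (h3 : IsSelfAdjoint V.γin) (k : Fin 3)
    (u v : E) : inner ℂ (V.pencil k u) v = inner ℂ u (V.pencil k v) := by
  have h : IsSelfAdjoint (V.pencil k) := by
    fin_cases k
    · exact h3
    · exact h2
    · exact h1.neg
  exact h.isSymmetric u v

/-- Syzygies of the cross product annihilate the principal subspace. -/
theorem VesselData.sum_inner_pencil_eq_zero [CompleteSpace E] (V : VesselData H E)
    (h1 : IsSelfAdjoint V.σ₁) (h2 : IsSelfAdjoint V.σ₂) (h3 : IsSelfAdjoint V.γin)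
    {R : Type*} [CommRing R] [IsDomain R] [Algebra ℝ R] {n : ℕ} (x : Fin 3 → R) (k : Fin 3)
    (hk : x k = 1) (q : Fin 3 → MIdx n → R)
    (hq : ∑ i, monomial i.toFinsupp 1 * ∑ l, C (q l i) *
      (X (l + 1) * C (x (l + 2)) - X (l + 2) * C (x (l + 1))) = (0 : MvPolynomial (Fin 3) R))
    (τ : R →ₗ[ℝ] E) (hτ : ∀ r, ∑ l, V.pencil l (τ (x l * r)) = 0)
    (w : BlownSpace n E) (hw : w ∈ V.principalSubspace n) :
    ∑ i, ∑ l, inner ℂ (w i) (V.pencil l (τ (q l i))) = 0 := by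
  let L : MIdx n → Fin 3 → R →+ ℂ := fun i l =>
    { toFun := fun r => inner ℂ (w i) (V.pencil l (τ r))
      map_zero' := by simp
      map_add' := by intro a b; simp }
  refine sum_pairing_eq_zero x k hk q hq L ?_ ?_
  · intro i r
    change ∑ l, inner ℂ (w i) (V.pencil l (τ (x l * r))) = 0
    rw [← inner_sum, hτ, inner_zero_right]
  · intro j a b c ha hb hc r
    change inner ℂ (w a) (V.pencil 0 (τ r)) + inner ℂ (w b) (V.pencil 1 (τ r)) +
      inner ℂ (w c) (V.pencil 2 (τ r)) = 0
    -- Moving the selfadjoint coefficients to the left factor turns the relation `Y` into the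
    -- equation that defines `Vₙ`.
    rw [← V.pencil_symm h1 h2 h3, ← V.pencil_symm h1 h2 h3, ← V.pencil_symm h1 h2 h3,
      ← inner_add_left, ← inner_add_left]
    have := hw j a b c ha hb hc
    simp only [VesselData.pencil, Matrix.cons_val_zero, Matrix.cons_val_one, Matrix.cons_val,
      neg_apply, ← sub_eq_add_neg]
    rw [this, inner_zero_left]

/-- The blown-up family `(τ (r xⁱ))ᵢ`. -/
noncomputable def blowUp {R : Type*} [CommRing R] [Algebra ℝ R] (n : ℕ) (x : Fin 3 → R) (τ : R →ₗ[ℝ] E)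
    (r : R) : BlownSpace n E := WithLp.toLp 2 fun i => τ (r * i.mono x)

/-- The equation of `Vₙ` at `j` is the hypothesis on `τ` applied to `r xʲ`. -/
theorem blowUp_mem_principalSubspace (V : VesselData H E)
    {R : Type*} [CommRing R] [Algebra ℝ R] (n : ℕ) (x : Fin 3 → R) (τ : R →ₗ[ℝ] E)
    (hτ : ∀ r, ∑ l, V.pencil l (τ (x l * r)) = 0) (r : R) :
    blowUp n x τ r ∈ V.principalSubspace n := by
  intro j a b c ha hb hc
  have h := hτ (r * (x 0 ^ j 0 * x 1 ^ j 1 * x 2 ^ j 2))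
  simp only [VesselData.pencil, Fin.sum_univ_three, Matrix.cons_val_zero, Matrix.cons_val_one,
    Matrix.cons_val, neg_apply, ← sub_eq_add_neg] at h
  rw [← h]
  have e0 : r * a.mono x = x 0 * (r * (x 0 ^ j 0 * x 1 ^ j 1 * x 2 ^ j 2)) := by
    simp [MIdx.mono, ha]; ring
  have e1 : r * b.mono x = x 1 * (r * (x 0 ^ j 0 * x 1 ^ j 1 * x 2 ^ j 2)) := by
    simp [MIdx.mono, hb]; ring
  have e2 : r * c.mono x = x 2 * (r * (x 0 ^ j 0 * x 1 ^ j 1 * x 2 ^ j 2)) := by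
    simp [MIdx.mono, hc]; ring
  simp only [blowUp, e0, e1, e2]

theorem VesselData.inner_blownBezout_blowUp (V : VesselData H E)
    {n : ℕ} {P Q : MvPolynomial (Fin 3) ℝ} (β : BezoutTriple n P Q)
    {R : Type*} [CommRing R] [Algebra ℝ R] (x : Fin 3 → R) (τ : R →ₗ[ℝ] E) (r : R)
    (w : BlownSpace n E) :
    inner ℂ w (V.blownBezout β (blowUp n x τ r)) =
      ∑ i, ∑ l, inner ℂ (w i) (V.pencil l (τ (r * β.freeze x l i))) := by
  rw [PiLp.inner_apply]
  refine Finset.sum_congr rfl fun i _ => ?_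
  rw [V.blownBezout_apply, Finset.sum_comm, inner_sum]
  refine Finset.sum_congr rfl fun l _ => congrArg _ ?_
  have : r * β.freeze x l i = ∑ j, β.coef l i j • (r * j.mono x) := by
    simp [BezoutTriple.freeze, Finset.mul_sum]
  rw [this]
  simp only [map_sum, map_smul, blowUp]
  refine Finset.sum_congr rfl fun j _ => ?_
  rw [← Complex.coe_smul, ← Complex.coe_smul, map_smul]

/-- A combination of Bezout operators whose symbols cancel at `x` annihilates the blow-up at `x`,
up to vectors orthogonal to the principal subspace. -/
theorem VesselData.inner_blownBezout_combination [CompleteSpace E] (V : VesselData H E)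
    (h1 : IsSelfAdjoint V.σ₁) (h2 : IsSelfAdjoint V.σ₂) (h3 : IsSelfAdjoint V.γin)
    {n : ℕ} {P : Fin 3 → MvPolynomial (Fin 3) ℝ} (β10 : BezoutTriple n (P 1) (P 0))
    (β20 : BezoutTriple n (P 2) (P 0)) (β12 : BezoutTriple n (P 1) (P 2))
    {R : Type*} [CommRing R] [IsDomain R] [Algebra ℝ R] (x : Fin 3 → R) (k : Fin 3)
    (hk : x k = 1) (τ : R →ₗ[ℝ] E) (hτ : ∀ r, ∑ l, V.pencil l (τ (x l * r)) = 0)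
    (w : BlownSpace n E) (hw : w ∈ V.principalSubspace n) :
    inner ℂ w (V.blownBezout β12 (blowUp n x τ (aeval x (P 0)))) +
      inner ℂ w (V.blownBezout β20 (blowUp n x τ (aeval x (P 1)))) -
      inner ℂ w (V.blownBezout β10 (blowUp n x τ (aeval x (P 2)))) = 0 := by
  rw [V.inner_blownBezout_blowUp, V.inner_blownBezout_blowUp, V.inner_blownBezout_blowUp]
  have := V.sum_inner_pencil_eq_zero h1 h2 h3 x k hk
    (fun l i => aeval x (P 0) * β12.freeze x l i + aeval x (P 1) * β20.freeze x l i -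
      aeval x (P 2) * β10.freeze x l i) ?_ τ hτ w hw
  · simpa only [map_add, map_sub, inner_add_right, inner_sub_right, Finset.sum_add_distrib,
      Finset.sum_sub_distrib] using this
  · have i12 := β12.freeze_identity x
    have i20 := β20.freeze_identity x
    have i10 := β10.freeze_identity x
    have : ∀ f g h : Fin 3 → MIdx n → R, ∀ a b c : R,
        ∑ i, monomial i.toFinsupp 1 * ∑ l, C (a * f l i + b * g l i - c * h l i) *
          (X (l + 1) * C (x (l + 2)) - X (l + 2) * C (x (l + 1))) =
        C a * (∑ i, monomial i.toFinsupp 1 * ∑ l, C (f l i) *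
          (X (l + 1) * C (x (l + 2)) - X (l + 2) * C (x (l + 1)))) +
        C b * (∑ i, monomial i.toFinsupp 1 * ∑ l, C (g l i) *
          (X (l + 1) * C (x (l + 2)) - X (l + 2) * C (x (l + 1)))) -
        C c * (∑ i, monomial i.toFinsupp 1 * ∑ l, C (h l i) *
          (X (l + 1) * C (x (l + 2)) - X (l + 2) * C (x (l + 1)))) := by
      intro f g h a b c
      simp only [Finset.mul_sum, ← Finset.sum_add_distrib, ← Finset.sum_sub_distrib]
      refine Finset.sum_congr rfl fun i _ => Finset.sum_congr rfl fun l _ => ?_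
      simp only [map_add, map_sub, map_mul]
      ring
    -- What remains is the expansion of a 3 × 3 determinant with rows `P(x)`, `P(Y)`, `P(x)`.
    rw [this, i12, i20, i10]
    ring

/-- A Bezout operator annihilates the blow-up at a common zero of its two polynomials, up to vectors
orthogonal to the principal subspace. -/
theorem VesselData.inner_blownBezout_eq_zero [CompleteSpace E] (V : VesselData H E)
    (h1 : IsSelfAdjoint V.σ₁) (h2 : IsSelfAdjoint V.σ₂) (h3 : IsSelfAdjoint V.γin)
    {n : ℕ} {P Q : MvPolynomial (Fin 3) ℝ} (β : BezoutTriple n P Q)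
    {R : Type*} [CommRing R] [IsDomain R] [Algebra ℝ R] (x : Fin 3 → R) (k : Fin 3)
    (hk : x k = 1) (hP : aeval x P = 0) (hQ : aeval x Q = 0)
    (τ : R →ₗ[ℝ] E) (hτ : ∀ r, ∑ l, V.pencil l (τ (x l * r)) = 0)
    (w : BlownSpace n E) (hw : w ∈ V.principalSubspace n) (r : R) :
    inner ℂ w (V.blownBezout β (blowUp n x τ r)) = 0 := by
  rw [V.inner_blownBezout_blowUp]
  have := V.sum_inner_pencil_eq_zero h1 h2 h3 x k hk (fun l i => β.freeze x l i)
    (by rw [β.freeze_identity x, hP, hQ]; simp)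
    (τ ∘ₗ LinearMap.mulLeft ℝ r) (by
      intro s
      rw [← hτ (r * s)]
      refine Finset.sum_congr rfl fun l _ => ?_
      simp only [LinearMap.comp_apply, LinearMap.mulLeft_apply]
      congr 2; ring) w hw
  simpa using this

theorem VesselData.inner_blownBezout_symm [CompleteSpace E] (V : VesselData H E)
    (h1 : IsSelfAdjoint V.σ₁) (h2 : IsSelfAdjoint V.σ₂) (h3 : IsSelfAdjoint V.γin)
    {n : ℕ} {P Q : MvPolynomial (Fin 3) ℝ} (β : BezoutTriple n P Q) (u w : BlownSpace n E) :
    inner ℂ (V.blownBezout β u) w = inner ℂ u (V.blownBezout β w) := by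
  rw [PiLp.inner_apply, PiLp.inner_apply]
  simp only [V.blownBezout_apply, sum_inner, inner_sum]
  rw [Finset.sum_comm]
  refine Finset.sum_congr rfl fun i _ => Finset.sum_congr rfl fun j _ =>
    Finset.sum_congr rfl fun k _ => ?_
  rw [← Complex.coe_smul, ← Complex.coe_smul, inner_smul_left, inner_smul_right,
    V.pencil_symm h1 h2 h3, β.coef_symm, Complex.conj_ofReal]

theorem VesselData.bezout_isSelfAdjoint [FiniteDimensional ℂ E] [CompleteSpace E]
    (V : VesselData H E)
    (h1 : IsSelfAdjoint V.σ₁) (h2 : IsSelfAdjoint V.σ₂) (h3 : IsSelfAdjoint V.γin)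
    {n : ℕ} {P Q : MvPolynomial (Fin 3) ℝ} (β : BezoutTriple n P Q) :
    IsSelfAdjoint (V.bezout β) := by
  rw [ContinuousLinearMap.isSelfAdjoint_iff_isSymmetric]
  intro u w
  change inner ℂ ((V.principalSubspace n).orthogonalProjectionOnto (V.blownBezout β u)) w =
    inner ℂ u ((V.principalSubspace n).orthogonalProjectionOnto (V.blownBezout β w))
  rw [Submodule.inner_orthogonalProjectionOnto_eq_of_mem_left,
    Submodule.inner_orthogonalProjectionOnto_eq_of_mem_right]
  exact V.inner_blownBezout_symm h1 h2 h3 β u w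

theorem VesselData.inner_bezout [FiniteDimensional ℂ E]
    (V : VesselData H E) {n : ℕ} {P Q : MvPolynomial (Fin 3) ℝ} (β : BezoutTriple n P Q)
    (u w : V.principalSubspace n) :
    inner ℂ w (V.bezout β u) = inner ℂ (w : BlownSpace n E) (V.blownBezout β u) :=
  Submodule.inner_orthogonalProjectionOnto_eq_of_mem_left w _

theorem VesselData.inner_smul_bezout [FiniteDimensional ℂ E]
    (V : VesselData H E) {n : ℕ} {P Q : MvPolynomial (Fin 3) ℝ} (β : BezoutTriple n P Q) (c : ℂ)
    (u w : V.principalSubspace n) :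
    inner ℂ w (c • V.bezout β u) = c * inner ℂ (w : BlownSpace n E) (V.blownBezout β u) := by
  rw [← V.inner_bezout]
  exact inner_smul_right w (V.bezout β u) c

end Pencil

/-! ### Compression of a vessel. -/

section Compression

variable {H E : Type*} [NormedAddCommGroup H] [InnerProductSpace ℂ H] [CompleteSpace H]
  [NormedAddCommGroup E] [InnerProductSpace ℂ E] [CompleteSpace E]

/-- The range of a selfadjoint operator is orthogonal to its kernel, hence here lies in `K`. -/
theorem starProjection_comp_eq {K : Submodule ℂ E} [K.HasOrthogonalProjection] {T : E →L[ℂ] E}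
    (hT : IsSelfAdjoint T) (h : ∀ v ∈ Kᗮ, T v = 0) : K.starProjection ∘L T = T := by
  ext v
  refine ext_inner_left ℂ fun w => ?_
  have hw : T (K.starProjection w) = T w := by
    have := h (w - K.starProjection w) (K.sub_starProjection_mem_orthogonal w)
    rw [map_sub, sub_eq_zero] at this
    exact this.symm
  rw [ContinuousLinearMap.comp_apply, ← Submodule.inner_starProjection_left_eq_right]
  have s := hT.isSymmetric
  exact (s _ _).symm.trans ((congrArg (fun u => inner ℂ u v) hw).trans (s _ _))

omit [CompleteSpace E] in
theorem comp_starProjection_eq {K : Submodule ℂ E} [K.HasOrthogonalProjection] {T : E →L[ℂ] E}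
    (h : ∀ v ∈ Kᗮ, T v = 0) : T ∘L K.starProjection = T := by
  ext v
  have := h (v - K.starProjection v) (K.sub_starProjection_mem_orthogonal v)
  rw [map_sub, sub_eq_zero] at this
  exact this.symm

/-- A vessel can be compressed to a subspace whose complement is annihilated by `σ₁`, `σ₂`, `γⁱⁿ`. -/
theorem VesselData.IsVessel.compress {V : VesselData H E} (hV : V.IsVessel)
    (K : Submodule ℂ E) [K.HasOrthogonalProjection] [CompleteSpace K]
    (h1 : ∀ v ∈ Kᗮ, V.σ₁ v = 0) (h2 : ∀ v ∈ Kᗮ, V.σ₂ v = 0) (h3 : ∀ v ∈ Kᗮ, V.γin v = 0) :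
    (V.compress K).IsVessel := by
  have a1 := starProjection_comp_eq hV.selfAdjoint_σ₁ h1
  have a2 := starProjection_comp_eq hV.selfAdjoint_σ₂ h2
  have b1 := comp_starProjection_eq h1
  have b2 := comp_starProjection_eq h2
  have b3 := comp_starProjection_eq h3
  set ι := K.subtypeL with hι
  set π := K.orthogonalProjectionOnto with hπ
  have hadj : π.adjoint = ι := by
    refine ((ContinuousLinearMap.eq_adjoint_iff _ _).mpr fun u v => ?_).symm
    exact (Submodule.inner_orthogonalProjectionOnto_eq_of_mem_left u v).symm
  have hadj' : ι.adjoint = π := by rw [← hadj, ContinuousLinearMap.adjoint_adjoint]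
  have hsa : ∀ T : E →L[ℂ] E, IsSelfAdjoint T → IsSelfAdjoint (π ∘L T ∘L ι) := by
    intro T hT
    rw [ContinuousLinearMap.isSelfAdjoint_iff', ContinuousLinearMap.adjoint_comp,
      ContinuousLinearMap.adjoint_comp, hadj, hadj', ContinuousLinearMap.isSelfAdjoint_iff'.mp hT]
    rfl
  have c1 : ∀ v, V.σ₁ (K.starProjection v) = V.σ₁ v := fun v => DFunLike.congr_fun b1 v
  have c2 : ∀ v, V.σ₂ (K.starProjection v) = V.σ₂ v := fun v => DFunLike.congr_fun b2 v
  have c3 : ∀ v, V.γin (K.starProjection v) = V.γin v := fun v => DFunLike.congr_fun b3 v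
  have d1 : ∀ v, K.starProjection (V.σ₁ v) = V.σ₁ v := fun v => DFunLike.congr_fun a1 v
  have d2 : ∀ v, K.starProjection (V.σ₂ v) = V.σ₂ v := fun v => DFunLike.congr_fun a2 v
  have hp : ∀ v, ι (π v) = K.starProjection v := fun v => rfl
  -- By linkage, `γᵒᵘᵗ` inherits the vanishing on the complement from the other three operators.
  have c4 : ∀ v, V.γout (K.starProjection v) = V.γout v := by
    intro v
    rw [hV.linkage]
    simp [c1, c2, c3]
  have key : ∀ S T : E →L[ℂ] E, (∀ v, S (K.starProjection v) = S v) →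
      (∀ v, K.starProjection (T v) = T v) →
      (π ∘L S ∘L ι) ∘L (π ∘L V.Φ) ∘L (π ∘L V.Φ).adjoint ∘L (π ∘L T ∘L ι) =
        π ∘L (S ∘L V.Φ ∘L V.Φ.adjoint ∘L T) ∘L ι := by
    intro S T hS hT
    rw [ContinuousLinearMap.adjoint_comp, hadj]
    ext v : 1
    simp only [ContinuousLinearMap.comp_apply, hp, hS, hT]
  refine ⟨hV.comm, hsa _ hV.selfAdjoint_σ₁, hsa _ hV.selfAdjoint_σ₂, hsa _ hV.selfAdjoint_γin,
    hsa _ hV.selfAdjoint_γout, ?_, ?_, ?_, ?_, ?_⟩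
  · change (π ∘L V.Φ).adjoint ∘L (π ∘L V.σ₁ ∘L ι) ∘L (π ∘L V.Φ) = _
    rw [ContinuousLinearMap.adjoint_comp, hadj]
    refine Eq.trans ?_ hV.colligation₁
    ext v : 1
    simp only [ContinuousLinearMap.comp_apply, hp, c1, d1]
  · change (π ∘L V.Φ).adjoint ∘L (π ∘L V.σ₂ ∘L ι) ∘L (π ∘L V.Φ) = _
    rw [ContinuousLinearMap.adjoint_comp, hadj]
    refine Eq.trans ?_ hV.colligation₂
    ext v : 1
    simp only [ContinuousLinearMap.comp_apply, hp, c2, d2]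
  · change (π ∘L V.γin ∘L ι) ∘L (π ∘L V.Φ) =
      (π ∘L V.σ₁ ∘L ι) ∘L (π ∘L V.Φ) ∘L V.A₂.adjoint -
        (π ∘L V.σ₂ ∘L ι) ∘L (π ∘L V.Φ) ∘L V.A₁.adjoint
    ext v : 1
    have := congrArg π (DFunLike.congr_fun hV.input v)
    simpa only [ContinuousLinearMap.comp_apply, hp, sub_apply, c1, c2, c3, map_sub] using this
  · change (π ∘L V.γout ∘L ι) ∘L (π ∘L V.Φ) =
      (π ∘L V.σ₁ ∘L ι) ∘L (π ∘L V.Φ) ∘L V.A₂ - (π ∘L V.σ₂ ∘L ι) ∘L (π ∘L V.Φ) ∘L V.A₁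
    ext v : 1
    have := congrArg π (DFunLike.congr_fun hV.output v)
    simpa only [ContinuousLinearMap.comp_apply, hp, sub_apply, c1, c2, c4, map_sub] using this
  · change π ∘L V.γout ∘L ι = π ∘L V.γin ∘L ι + Complex.I •
      ((π ∘L V.σ₁ ∘L ι) ∘L (π ∘L V.Φ) ∘L (π ∘L V.Φ).adjoint ∘L (π ∘L V.σ₂ ∘L ι) -
        (π ∘L V.σ₂ ∘L ι) ∘L (π ∘L V.Φ) ∘L (π ∘L V.Φ).adjoint ∘L (π ∘L V.σ₁ ∘L ι))
    rw [key _ _ c1 d2, key _ _ c2 d1, hV.linkage]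
    ext v : 1
    simp

end Compression

/-! ### Existence of symmetric Bezout matrices. -/

/-- The monomial `x^a y^b`. -/
noncomputable def biMonomial (a b : Fin 3 → ℕ) : MvPolynomial (Fin 3 ⊕ Fin 3) ℝ :=
  (X (Sum.inl 0) ^ a 0 * X (Sum.inl 1) ^ a 1 * X (Sum.inl 2) ^ a 2) *
    (X (Sum.inr 0) ^ b 0 * X (Sum.inr 1) ^ b 1 * X (Sum.inr 2) ^ b 2)

/-- The Bezout form with coefficients `β¹⁰, β²⁰, β¹²` (not necessarily symmetric). -/
noncomputable def bezoutForm (n : ℕ) :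
    (Matrix (MIdx n) (MIdx n) ℝ × Matrix (MIdx n) (MIdx n) ℝ × Matrix (MIdx n) (MIdx n) ℝ) →ₗ[ℝ]
      MvPolynomial (Fin 3 ⊕ Fin 3) ℝ where
  toFun β := ∑ i, ∑ j, xMonomial i *
    (C (β.1 i j) * xyMinor 1 0 + C (β.2.1 i j) * xyMinor 2 0 + C (β.2.2 i j) * xyMinor 1 2) *
      yMonomial j
  map_add' β γ := by
    simp only [← Finset.sum_add_distrib]
    refine Finset.sum_congr rfl fun i _ => Finset.sum_congr rfl fun j _ => ?_
    simp only [Prod.fst_add, Prod.snd_add, Matrix.add_apply, map_add]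
    ring
  map_smul' r β := by
    simp only [Finset.smul_sum, RingHom.id_apply]
    refine Finset.sum_congr rfl fun i _ => Finset.sum_congr rfl fun j _ => ?_
    simp only [Prod.smul_fst, Prod.smul_snd, Matrix.smul_apply, smul_eq_mul, map_mul,
      MvPolynomial.smul_eq_C_mul]
    ring

theorem bezoutForm_single {n : ℕ} (i j : MIdx n) (a b c : ℝ) :
    bezoutForm n (Matrix.single i j a, Matrix.single i j b, Matrix.single i j c) =
      xMonomial i * (C a * xyMinor 1 0 + C b * xyMinor 2 0 + C c * xyMinor 1 2) * yMonomial j := by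
  change ∑ k, ∑ l, _ = _
  rw [Finset.sum_eq_single i, Finset.sum_eq_single j]
  · simp
  · intro l _ hl
    simp [hl.symm]
  · simp
  · intro k _ hk
    refine Finset.sum_eq_zero fun l _ => ?_
    simp [hk.symm]
  · simp

theorem minor_mem_range_bezoutForm {n : ℕ} (i j : MIdx n) (k l : Fin 3) :
    xMonomial i * xyMinor k l * yMonomial j ∈ LinearMap.range (bezoutForm n) := by
  have h : ∃ a b c : ℝ, (xyMinor k l : MvPolynomial (Fin 3 ⊕ Fin 3) ℝ) =
      C a * xyMinor 1 0 + C b * xyMinor 2 0 + C c * xyMinor 1 2 := by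
    fin_cases k <;> fin_cases l
    · exact ⟨0, 0, 0, by simp [xyMinor]⟩
    · exact ⟨-1, 0, 0, by simp [xyMinor]⟩
    · exact ⟨0, -1, 0, by simp [xyMinor]⟩
    · exact ⟨1, 0, 0, by simp [xyMinor]⟩
    · exact ⟨0, 0, 0, by simp [xyMinor]⟩
    · exact ⟨0, 0, 1, by simp [xyMinor]⟩
    · exact ⟨0, 1, 0, by simp [xyMinor]⟩
    · exact ⟨0, 0, -1, by simp [xyMinor]⟩
    · exact ⟨0, 0, 0, by simp [xyMinor]⟩
  obtain ⟨a, b, c, h⟩ := h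
  exact ⟨_, by rw [h]; exact bezoutForm_single i j a b c⟩

theorem X_mul_prod_pow (f : Fin 3 → MvPolynomial (Fin 3 ⊕ Fin 3) ℝ) (k : Fin 3) (a : Fin 3 → ℕ) :
    f 0 ^ (a + (Pi.single k 1 : Fin 3 → ℕ)) 0 * f 1 ^ (a + (Pi.single k 1 : Fin 3 → ℕ)) 1 * f 2 ^ (a + (Pi.single k 1 : Fin 3 → ℕ)) 2 =
      f k * (f 0 ^ a 0 * f 1 ^ a 1 * f 2 ^ a 2) := by
  fin_cases k <;> simp <;> ring

/-- Exchanging one `x_k` with one `y_l` changes a monomial by a monomial multiple of `x_k y_l - x_l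
y_k`. Choosing `k` with `a k > c k` and `l` with `a l < c l` lowers the excess `N` of `a` over `c`
(a sum of truncated differences) by one. -/
theorem biMonomial_sub_mem_range {n : ℕ} (N : ℕ) : ∀ a b c d : Fin 3 → ℕ, a + b = c + d →
    a 0 + a 1 + a 2 = n → b 0 + b 1 + b 2 = n → c 0 + c 1 + c 2 = n →
    (a 0 - c 0) + (a 1 - c 1) + (a 2 - c 2) = N →
    biMonomial a b - biMonomial c d ∈ LinearMap.range (bezoutForm n) := by
  induction N using Nat.strong_induction_on with
  | _ N ih =>
    intro a b c d habcd ha hb hc hN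
    have h0 := congrFun habcd 0
    have h1 := congrFun habcd 1
    have h2 := congrFun habcd 2
    simp only [Pi.add_apply] at h0 h1 h2
    by_cases hac : a = c
    · subst hac
      have : b = d := add_left_cancel habcd
      rw [this, sub_self]
      exact Submodule.zero_mem _
    · have hk : ∃ k, c k < a k := by
        by_contra! h
        apply hac
        have := h 0; have := h 1; have := h 2
        ext k; fin_cases k <;> simp <;> omega
      have hl : ∃ l, a l < c l := by
        by_contra! h
        apply hac
        have := h 0; have := h 1; have := h 2
        ext k; fin_cases k <;> simp <;> omega
      obtain ⟨k, hk⟩ := hk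
      obtain ⟨l, hl⟩ := hl
      have hl' : d l < b l := by
        have := congrFun habcd l
        simp only [Pi.add_apply] at this
        omega
      obtain ⟨a', rfl⟩ : ∃ a', a = a' + Pi.single k 1 := ⟨a - Pi.single k 1, by
        ext m; by_cases hm : m = k
        · subst hm; simp; omega
        · simp [hm]⟩
      obtain ⟨b', rfl⟩ : ∃ b', b = b' + Pi.single l 1 := ⟨b - Pi.single l 1, by
        ext m; by_cases hm : m = l
        · subst hm; simp; omega
        · simp [hm]⟩
      have hkl : k ≠ l := by rintro rfl; omega
      have hs : ∀ (k : Fin 3) (a : Fin 3 → ℕ), (a + (Pi.single k 1 : Fin 3 → ℕ)) 0 + (a + (Pi.single k 1 : Fin 3 → ℕ)) 1 +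
          (a + (Pi.single k 1 : Fin 3 → ℕ)) 2 = a 0 + a 1 + a 2 + 1 := by
        intro k a; fin_cases k <;> simp <;> omega
      have step : biMonomial (a' + Pi.single k 1) (b' + Pi.single l 1) -
          biMonomial (a' + Pi.single l 1) (b' + Pi.single k 1) ∈
          LinearMap.range (bezoutForm n) := by
        have := minor_mem_range_bezoutForm (n := n) ⟨a', by rw [← ha, hs]⟩ ⟨b', by rw [← hb, hs]⟩ k l
        convert this using 1
        simp only [biMonomial, xMonomial, yMonomial, xyMinor,
          X_mul_prod_pow (fun m => X (Sum.inl m)), X_mul_prod_pow (fun m => X (Sum.inr m))]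
        ring
      have rest := ih ((a' + (Pi.single l 1 : Fin 3 → ℕ)) 0 - c 0 + ((a' + (Pi.single l 1 : Fin 3 → ℕ)) 1 - c 1) +
        ((a' + (Pi.single l 1 : Fin 3 → ℕ)) 2 - c 2)) (by
          rw [← hN]
          have hk0 := hk; have hl0 := hl
          fin_cases k <;> fin_cases l <;> simp at hk0 hl0 hkl ⊢ <;> omega)
        (a' + Pi.single l 1) (b' + Pi.single k 1) c d
        (by rw [← habcd]; abel) (by rw [← ha, hs, hs]) (by rw [← hb, hs, hs]) hc rfl
      have := Submodule.add_mem _ step rest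
      rwa [sub_add_sub_cancel] at this

theorem rename_inl_monomial (d : Fin 3 →₀ ℕ) (r : ℝ) :
    rename (Sum.inl : Fin 3 → Fin 3 ⊕ Fin 3) (monomial d r) =
      C r * (X (Sum.inl 0) ^ d 0 * X (Sum.inl 1) ^ d 1 * X (Sum.inl 2) ^ d 2) := by
  rw [monomial_eq, Finsupp.prod_fintype _ _ (by simp), Fin.prod_univ_three]
  simp

theorem rename_inr_monomial (d : Fin 3 →₀ ℕ) (r : ℝ) :
    rename (Sum.inr : Fin 3 → Fin 3 ⊕ Fin 3) (monomial d r) =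
      C r * (X (Sum.inr 0) ^ d 0 * X (Sum.inr 1) ^ d 1 * X (Sum.inr 2) ^ d 2) := by
  rw [monomial_eq, Finsupp.prod_fintype _ _ (by simp), Fin.prod_univ_three]
  simp

theorem antisymm_mem_range_bezoutForm {n : ℕ} {P Q : MvPolynomial (Fin 3) ℝ}
    (hP : P.IsHomogeneous n) (hQ : Q.IsHomogeneous n) :
    rename Sum.inl P * rename Sum.inr Q - rename Sum.inl Q * rename Sum.inr P ∈
      LinearMap.range (bezoutForm n) := by
  have hdeg : ∀ {F : MvPolynomial (Fin 3) ℝ}, F.IsHomogeneous n → ∀ d ∈ F.support,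
      d 0 + d 1 + d 2 = n := by
    intro F hF d hd
    have := hF (mem_support_iff.mp hd)
    simpa [Finsupp.weight_apply, Finsupp.sum_fintype, Fin.sum_univ_three] using this
  have key : rename Sum.inl P * rename Sum.inr Q - rename Sum.inl Q * rename Sum.inr P =
      ∑ d ∈ P.support, ∑ e ∈ Q.support,
        (P.coeff d * Q.coeff e) • (biMonomial d e - biMonomial e d) := by
    conv_lhs => rw [P.as_sum, Q.as_sum]
    simp only [map_sum, Finset.sum_mul, Finset.mul_sum, rename_inl_monomial, rename_inr_monomial]
    rw [Finset.sum_comm (s := Q.support), ← Finset.sum_sub_distrib]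
    refine Finset.sum_congr rfl fun d _ => ?_
    rw [← Finset.sum_sub_distrib]
    refine Finset.sum_congr rfl fun e _ => ?_
    rw [MvPolynomial.smul_eq_C_mul, map_mul, biMonomial, biMonomial]
    ring
  rw [key]
  refine Submodule.sum_mem _ fun d hd => Submodule.sum_mem _ fun e he =>
    Submodule.smul_mem _ _ ?_
  exact biMonomial_sub_mem_range _ d e e d (add_comm _ _) (hdeg hP d hd) (hdeg hQ e he)
    (hdeg hQ e he) rfl

/-- The minors change sign under `x ↔ y`, while the two monomials trade places. -/
theorem rename_swap_bezoutForm {n : ℕ}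
    (β : Matrix (MIdx n) (MIdx n) ℝ × Matrix (MIdx n) (MIdx n) ℝ × Matrix (MIdx n) (MIdx n) ℝ) :
    rename Sum.swap (bezoutForm n β) =
      -bezoutForm n (β.1.transpose, β.2.1.transpose, β.2.2.transpose) := by
  change rename Sum.swap (∑ i, ∑ j, _) = -∑ i, ∑ j, _
  rw [Finset.sum_comm, map_sum, ← Finset.sum_neg_distrib]
  refine Finset.sum_congr rfl fun i _ => ?_
  rw [map_sum, ← Finset.sum_neg_distrib]
  refine Finset.sum_congr rfl fun j _ => ?_
  simp only [xMonomial, yMonomial, xyMinor, map_mul, map_add, map_sub, map_pow, rename_X,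
    rename_C, Sum.swap_inl, Sum.swap_inr, Matrix.transpose_apply]
  ring

/-- The left side is antisymmetric under `x ↔ y`, so the transposes of a solution are again a
solution; the average of the two is symmetric. -/
theorem nonempty_bezoutTriple {n : ℕ} {P Q : MvPolynomial (Fin 3) ℝ}
    (hP : P.IsHomogeneous n) (hQ : Q.IsHomogeneous n) : Nonempty (BezoutTriple n P Q) := by
  obtain ⟨β, hβ⟩ := antisymm_mem_range_bezoutForm hP hQ
  have hβ' : bezoutForm n (β.1.transpose, β.2.1.transpose, β.2.2.transpose) =
      rename Sum.inl P * rename Sum.inr Q - rename Sum.inl Q * rename Sum.inr P := by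
    have h := rename_swap_bezoutForm β
    rw [hβ] at h
    rw [← neg_inj, ← h]
    have e1 : (Sum.swap ∘ Sum.inl : Fin 3 → Fin 3 ⊕ Fin 3) = Sum.inr := rfl
    have e2 : (Sum.swap ∘ Sum.inr : Fin 3 → Fin 3 ⊕ Fin 3) = Sum.inl := rfl
    simp only [map_sub, map_mul, rename_rename, e1, e2]
    ring
  let γ := (2⁻¹ : ℝ) • (β + (β.1.transpose, β.2.1.transpose, β.2.2.transpose))
  have hγ : bezoutForm n γ =
      rename Sum.inl P * rename Sum.inr Q - rename Sum.inl Q * rename Sum.inr P := by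
    rw [map_smul, map_add, hβ, hβ', ← two_smul ℝ, smul_smul]
    simp
  have hs : ∀ b : Matrix (MIdx n) (MIdx n) ℝ, ((2⁻¹ : ℝ) • (b + b.transpose)).IsSymm := by
    intro b
    ext i j
    simp; ring
  exact ⟨⟨γ.1, γ.2.1, γ.2.2, hs _, hs _, hs _, hγ.symm⟩⟩

theorem homogenizeTo_isHomogeneous {n : ℕ} {p : MvPolynomial (Fin 2) ℝ} (h : p.totalDegree ≤ n) :
    (homogenizeTo n p).IsHomogeneous n := by
  refine IsHomogeneous.sum _ _ _ fun d hd => ?_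
  have hd' : d 0 + d 1 ≤ n := by
    have := le_totalDegree hd
    rw [Finsupp.sum_fintype _ _ (by simp), Fin.sum_univ_two] at this
    omega
  have h1 : ∀ (k : Fin 3) m, ((X k : MvPolynomial (Fin 3) ℝ) ^ m).IsHomogeneous m := by
    intro k m; simpa using (isHomogeneous_X ℝ k).pow m
  have := (isHomogeneous_C (Fin 3) (p.coeff d)).mul
    (((h1 0 (n - (d 0 + d 1))).mul (h1 1 (d 0))).mul (h1 2 (d 1)))
  rwa [show 0 + (n - (d 0 + d 1) + d 0 + d 1) = n by omega] at this

theorem homogenizeTo_maxDegree_isHomogeneous (p : Fin 3 → MvPolynomial (Fin 2) ℝ) (k : Fin 3) :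
    (homogenizeTo (maxDegree p) (p k)).IsHomogeneous (maxDegree p) := by
  apply homogenizeTo_isHomogeneous
  fin_cases k <;> simp [maxDegree]

theorem nonempty_bezoutChoice (p : Fin 3 → MvPolynomial (Fin 2) ℝ) : Nonempty (BezoutChoice p) := by
  have h := homogenizeTo_maxDegree_isHomogeneous p
  obtain ⟨a⟩ := nonempty_bezoutTriple (h 1) (h 0)
  obtain ⟨b⟩ := nonempty_bezoutTriple (h 2) (h 0)
  obtain ⟨c⟩ := nonempty_bezoutTriple (h 1) (h 2)
  exact ⟨⟨a, b, c⟩⟩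

/-! ### Polynomial calculus and the Bezout identity for operators. -/

section Calculus

open scoped TensorProduct

variable {H : Type*} [NormedAddCommGroup H] [InnerProductSpace ℂ H]

/-- The polynomial calculus `p ↦ p(A, B)` of two commuting operators. -/
theorem exists_polyOp_algHom {A B : H →L[ℂ] H} (h : A ∘L B = B ∘L A) :
    ∃ ρ : MvPolynomial (Fin 2) ℝ →ₐ[ℝ] (H →L[ℂ] H), ρ (X 0) = A ∧ ρ (X 1) = B ∧
      ∀ p, ρ p = polyOp p A B := by
  have hcomm : ∀ a ∈ ({A, B} : Set (H →L[ℂ] H)), ∀ b ∈ ({A, B} : Set (H →L[ℂ] H)),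
      a * b = b * a := by
    rintro a (rfl | rfl) b (rfl | rfl)
    · rfl
    · exact h
    · exact h.symm
    · rfl
  -- Polynomials are evaluated in the commutative subalgebra generated by `A` and `B`.
  let S := Algebra.adjoin ℝ ({A, B} : Set (H →L[ℂ] H))
  have hS : IsMulCommutative S := Algebra.isMulCommutative_adjoin ℝ hcomm
  let _ : CommRing S := { S.toRing with mul_comm := hS.is_comm.comm }
  let a : S := ⟨A, Algebra.subset_adjoin (by simp)⟩
  let b : S := ⟨B, Algebra.subset_adjoin (by simp)⟩
  let ρ : MvPolynomial (Fin 2) ℝ →ₐ[ℝ] (H →L[ℂ] H) := S.val.comp (aeval ![a, b])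
  refine ⟨ρ, ?_, ?_, ?_⟩
  · simp [ρ, a]
  · simp [ρ, b]
  · intro p
    conv_lhs => rw [p.as_sum]
    rw [map_sum, polyOp]
    refine Finset.sum_congr rfl fun d _ => ?_
    have : ρ (monomial d (coeff d p)) = coeff d p • (A ^ d 0 * B ^ d 1) := by
      simp [ρ, aeval_monomial, Finsupp.prod_fintype, Fin.prod_univ_two, a, b, Algebra.smul_def]
    rw [this]
    rfl

/-- The polynomial calculus as an algebra homomorphism. -/
noncomputable def polyHom {A B : H →L[ℂ] H} (h : A ∘L B = B ∘L A) :
    MvPolynomial (Fin 2) ℝ →ₐ[ℝ] (H →L[ℂ] H) := (exists_polyOp_algHom h).choose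

theorem polyHom_X_zero {A B : H →L[ℂ] H} (h : A ∘L B = B ∘L A) : polyHom h (X 0) = A :=
  (exists_polyOp_algHom h).choose_spec.1

theorem polyHom_X_one {A B : H →L[ℂ] H} (h : A ∘L B = B ∘L A) : polyHom h (X 1) = B :=
  (exists_polyOp_algHom h).choose_spec.2.1

theorem polyHom_apply {A B : H →L[ℂ] H} (h : A ∘L B = B ∘L A) (p : MvPolynomial (Fin 2) ℝ) :
    polyHom h p = polyOp p A B :=
  (exists_polyOp_algHom h).choose_spec.2.2 p

theorem polyOp_adjoint [CompleteSpace H] {A B : H →L[ℂ] H} (h : A ∘L B = B ∘L A)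
    (p : MvPolynomial (Fin 2) ℝ) : (polyOp p A B).adjoint = polyOp p A.adjoint B.adjoint := by
  have h' : A * B = B * A := h
  simp only [polyOp, map_sum, ← ContinuousLinearMap.star_eq_adjoint]
  refine Finset.sum_congr rfl fun d _ => ?_
  have : (A ^ d 0 * B ^ d 1) = B ^ d 1 * A ^ d 0 := ((show Commute A B from h').pow_pow _ _).eq
  rw [star_smul, this, star_mul, star_pow, star_pow]
  simp

/-- The affine point `(1, y₁, y₂)` over the polynomial ring. -/
noncomputable def affinePoint : Fin 3 → MvPolynomial (Fin 2) ℝ := ![1, X 0, X 1]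

theorem aeval_homogenizeTo {S : Type*} [CommRing S] [Algebra ℝ S] (y : Fin 2 → S) (n : ℕ)
    (p : MvPolynomial (Fin 2) ℝ) : aeval ![1, y 0, y 1] (homogenizeTo n p) = aeval y p := by
  conv_rhs => rw [p.as_sum]
  rw [homogenizeTo, map_sum, map_sum]
  refine Finset.sum_congr rfl fun d _ => ?_
  simp [aeval_monomial, Finsupp.prod_fintype, Fin.prod_univ_two]

theorem aeval_affinePoint (n : ℕ) (p : MvPolynomial (Fin 2) ℝ) :
    aeval affinePoint (homogenizeTo n p) = p := by
  have h := aeval_homogenizeTo (X : Fin 2 → MvPolynomial (Fin 2) ℝ) n p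
  rw [aeval_X_left_apply] at h
  exact h

/-- Left-right substitution of two polynomial calculi in the Bezout identity. -/
theorem BezoutTriple.operator_identity {n : ℕ} {P Q : MvPolynomial (Fin 3) ℝ}
    (β : BezoutTriple n P Q) {R B : Type*} [CommRing R] [Algebra ℝ R] [Ring B] [Algebra ℝ B]
    (ρ ρ' : R →ₐ[ℝ] B) (x : Fin 3 → R) :
    ρ (aeval x P) * ρ' (aeval x Q) - ρ (aeval x Q) * ρ' (aeval x P) =
      ∑ i : MIdx n, ∑ j : MIdx n, ∑ k, β.coef k i j • (ρ (i.mono x) *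
        (ρ (x (k + 1)) * ρ' (x (k + 2)) - ρ (x (k + 2)) * ρ' (x (k + 1))) * ρ' (j.mono x)) := by
  -- Values of `ρ` need not commute with values of `ρ'`. The identity holds in the commutative ring
  -- `R ⊗ R`, and the merely linear map `a ⊗ b ↦ ρ a * ρ' b` carries it over with all `ρ`-factors on
  -- the left.
  let μ : R ⊗[ℝ] R →ₗ[ℝ] B :=
    TensorProduct.lift ((LinearMap.mul ℝ B).compl₁₂ ρ.toLinearMap ρ'.toLinearMap)
  have hμ : ∀ a b, μ (a ⊗ₜ b) = ρ a * ρ' b := fun a b => by simp [μ]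
  let l : R →ₐ[ℝ] R ⊗[ℝ] R := Algebra.TensorProduct.includeLeft
  let r : R →ₐ[ℝ] R ⊗[ℝ] R := Algebra.TensorProduct.includeRight
  have hlr : ∀ a b, l a * r b = a ⊗ₜ b := fun a b => by simp [l, r]
  have hl : ∀ F : MvPolynomial (Fin 3) ℝ, aeval (fun k => l (x k)) F = l (aeval x F) :=
    fun F => (comp_aeval_apply x l F).symm
  have hr : ∀ F : MvPolynomial (Fin 3) ℝ, aeval (fun k => r (x k)) F = r (aeval x F) :=
    fun F => (comp_aeval_apply x r F).symm
  have hml : ∀ i : MIdx n, i.mono (fun k => l (x k)) = l (i.mono x) := fun i => by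
    simp only [MIdx.mono, map_mul, map_pow]
  have hmr : ∀ i : MIdx n, i.mono (fun k => r (x k)) = r (i.mono x) := fun i => by
    simp only [MIdx.mono, map_mul, map_pow]
  have h := congrArg μ (β.aeval_identity (fun k => l (x k)) (fun k => r (x k)))
  rw [hl, hr, hl, hr, hlr, hlr, map_sub, hμ, hμ] at h
  rw [h, map_sum]
  refine Finset.sum_congr rfl fun i _ => ?_
  rw [map_sum]
  refine Finset.sum_congr rfl fun j _ => ?_
  rw [hml, hmr, Finset.mul_sum, Finset.sum_mul, map_sum]
  refine Finset.sum_congr rfl fun k _ => ?_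
  have : l (i.mono x) * (algebraMap ℝ (R ⊗[ℝ] R) (β.coef k i j) *
      (l (x (k + 1)) * r (x (k + 2)) - l (x (k + 2)) * r (x (k + 1)))) * r (j.mono x) =
      β.coef k i j • (l (i.mono x * x (k + 1)) * r (x (k + 2) * j.mono x) -
        l (i.mono x * x (k + 2)) * r (x (k + 1) * j.mono x)) := by
    rw [Algebra.smul_def]
    simp only [map_mul]
    ring
  rw [this, map_smul, map_sub, hlr, hlr, hμ, hμ]
  simp only [map_mul]
  congr 1
  noncomm_ring

end Calculus

/-! ### Blown-up orbits and the map `Φ'`. -/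

section Transform

variable {H E : Type*} [NormedAddCommGroup H] [InnerProductSpace ℂ H] [CompleteSpace H]
  [NormedAddCommGroup E] [InnerProductSpace ℂ E] [FiniteDimensional ℂ E] [CompleteSpace E]
  {V : VesselData H E}

omit [FiniteDimensional ℂ E] in
theorem VesselData.IsVessel.comm_adjoint (hV : V.IsVessel) :
    V.A₁.adjoint ∘L V.A₂.adjoint = V.A₂.adjoint ∘L V.A₁.adjoint := by
  rw [← ContinuousLinearMap.adjoint_comp, ← ContinuousLinearMap.adjoint_comp, hV.comm]

/-- The map `r ↦ Φ r(A₁*, A₂*) h`. -/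
noncomputable def VesselData.IsVessel.orbit (hV : V.IsVessel) (h : H) :
    MvPolynomial (Fin 2) ℝ →ₗ[ℝ] E where
  toFun r := V.Φ (polyHom hV.comm_adjoint r h)
  map_add' r s := by simp
  map_smul' c r := by
    rw [map_smul]
    exact (congrArg V.Φ (Complex.coe_smul c _).symm).trans
      ((V.Φ.map_smul _ _).trans (Complex.coe_smul c _))

omit [FiniteDimensional ℂ E] in
theorem VesselData.IsVessel.orbit_apply (hV : V.IsVessel) (h : H) (r : MvPolynomial (Fin 2) ℝ) :
    hV.orbit h r = V.Φ (polyHom hV.comm_adjoint r h) := rfl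

-- This is the input condition at `r(A₁*, A₂*) h`. It puts blown-up orbits in `Vₙ`, so the
-- projection in `Φ'` acts trivially.
omit [FiniteDimensional ℂ E] in
theorem VesselData.IsVessel.sum_pencil_orbit (hV : V.IsVessel) (h : H)
    (r : MvPolynomial (Fin 2) ℝ) :
    ∑ l, V.pencil l (hV.orbit h (affinePoint l * r)) = 0 := by
  have := DFunLike.congr_fun hV.input (polyHom hV.comm_adjoint r h)
  simp only [ContinuousLinearMap.comp_apply, sub_apply] at this
  simp only [Fin.sum_univ_three, hV.orbit_apply, affinePoint, VesselData.pencil,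
    Matrix.cons_val_zero, Matrix.cons_val_one, Matrix.cons_val, neg_apply, map_mul,
    polyHom_X_zero, polyHom_X_one, map_one, mul_apply_eq_comp, one_apply_eq_self]
  rw [this]
  abel

variable (p : Fin 3 → MvPolynomial (Fin 2) ℝ)

/-- The value `Φ' h` is the blow-up of the orbit of `p₀(A₁*, A₂*)⁻¹ h`. -/
theorem VesselData.IsVessel.transformΦ_apply (hV : V.IsVessel) (h : H) :
    (V.transformΦ p h : BlownSpace (maxDegree p) E) =
      blowUp (maxDegree p) affinePoint
        (hV.orbit (Ring.inverse (polyOp (p 0) V.A₁.adjoint V.A₂.adjoint) h)) 1 := by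
  set g := Ring.inverse (polyOp (p 0) V.A₁.adjoint V.A₂.adjoint) h with hg
  have hmem := blowUp_mem_principalSubspace V (maxDegree p) affinePoint (hV.orbit g)
    (hV.sum_pencil_orbit g) 1
  have e : V.transformΦ p h = (V.transformSpace p).orthogonalProjectionOnto
      (blowUp (maxDegree p) affinePoint (hV.orbit g) 1) := by
    refine congrArg (V.transformSpace p).orthogonalProjectionOnto ?_
    ext i
    simp only [blowUp, hV.orbit_apply, MIdx.mono, affinePoint, Matrix.cons_val_zero,
      Matrix.cons_val_one, Matrix.cons_val, one_pow, one_mul, map_mul, map_pow, polyHom_X_zero,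
      polyHom_X_one]
    rfl
  rw [e]
  exact Submodule.starProjection_eq_self_iff.mpr hmem

omit [FiniteDimensional ℂ E] in
theorem VesselData.IsVessel.blowUp_orbit (hV : V.IsVessel) (n : ℕ) (h : H)
    (r : MvPolynomial (Fin 2) ℝ) :
    blowUp n affinePoint (hV.orbit h) r =
      blowUp n affinePoint (hV.orbit (polyHom hV.comm_adjoint r h)) 1 := by
  ext i
  simp only [blowUp, hV.orbit_apply, one_mul]
  rw [mul_comm, map_mul]
  rfl

end Transform

theorem Commute.ringInverse_right_of_isUnit {B : Type*} [Ring B] {a b : B} (h : Commute a b)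
    (hb : IsUnit b) : Commute a (Ring.inverse b) := by
  obtain ⟨u, rfl⟩ := hb
  rw [Ring.inverse_unit]
  exact h.units_inv_right

/-! ### The vessel conditions for `V'`. -/

section Transform

variable {H E : Type*} [NormedAddCommGroup H] [InnerProductSpace ℂ H] [CompleteSpace H]
  [NormedAddCommGroup E] [InnerProductSpace ℂ E] [FiniteDimensional ℂ E] [CompleteSpace E]
  {V : VesselData H E}

omit [FiniteDimensional ℂ E] in
/-- `Φ* s_k Φ` is the `k`-th entry of `(1/i) (1, A₁, A₂) × (1, A₁*, A₂*)`. -/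
theorem VesselData.IsVessel.adjoint_pencil (hV : V.IsVessel) (k : Fin 3) :
    V.Φ.adjoint ∘L V.pencil k ∘L V.Φ = (1 / Complex.I) •
      (polyHom hV.comm (affinePoint (k + 1)) * polyHom hV.comm_adjoint (affinePoint (k + 2)) -
        polyHom hV.comm (affinePoint (k + 2)) * polyHom hV.comm_adjoint (affinePoint (k + 1))) := by
  have c1 := hV.colligation₁
  have c2 := hV.colligation₂
  have h12 := hV.comm_adjoint
  fin_cases k
  · change V.Φ.adjoint ∘L (V.γin ∘L V.Φ) = (1 / Complex.I) •
      (polyHom hV.comm (X 0) * polyHom hV.comm_adjoint (X 1) -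
        polyHom hV.comm (X 1) * polyHom hV.comm_adjoint (X 0))
    -- The input condition reduces `γⁱⁿ` to the two colligation conditions; the products of two
    -- adjoints then cancel by commutation.
    rw [hV.input]
    simp only [polyHom_X_zero, polyHom_X_one]
    ext v : 1
    have e1 := DFunLike.congr_fun c1 (V.A₂.adjoint v)
    have e2 := DFunLike.congr_fun c2 (V.A₁.adjoint v)
    have e3 := DFunLike.congr_fun h12 v
    simp only [ContinuousLinearMap.comp_apply, sub_apply, smul_apply, mul_apply_eq_comp,
      map_sub] at e1 e2 e3 ⊢
    rw [e1, e2, e3, ← smul_sub]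
    congr 1
    abel
  · change V.Φ.adjoint ∘L V.σ₂ ∘L V.Φ = (1 / Complex.I) •
      (polyHom hV.comm (X 1) * polyHom hV.comm_adjoint 1 -
        polyHom hV.comm 1 * polyHom hV.comm_adjoint (X 1))
    simp only [polyHom_X_one, map_one, one_mul, mul_one]
    exact c2
  · change V.Φ.adjoint ∘L (-V.σ₁) ∘L V.Φ = (1 / Complex.I) •
      (polyHom hV.comm 1 * polyHom hV.comm_adjoint (X 0) -
        polyHom hV.comm (X 0) * polyHom hV.comm_adjoint 1)
    simp only [polyHom_X_zero, map_one, one_mul, mul_one]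
    rw [← neg_sub, smul_neg, ← c1]
    ext v : 1
    simp

omit [FiniteDimensional ℂ E] in
theorem VesselData.IsVessel.adjoint_polyHom (hV : V.IsVessel) (r : MvPolynomial (Fin 2) ℝ) :
    (polyHom hV.comm r).adjoint = polyHom hV.comm_adjoint r := by
  rw [polyHom_apply, polyHom_apply, polyOp_adjoint hV.comm]

-- Each block `Φ* s_k Φ` is a cross product entry by `adjoint_pencil`, so the sum over the blocks is
-- the right side of `operator_identity`.
omit [FiniteDimensional ℂ E] in
theorem VesselData.IsVessel.inner_bezout_orbit (hV : V.IsVessel) {n : ℕ}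
    {P Q : MvPolynomial (Fin 3) ℝ} (β : BezoutTriple n P Q) (g g' : H) :
    inner ℂ (blowUp n affinePoint (hV.orbit g') 1)
      (V.blownBezout β (blowUp n affinePoint (hV.orbit g) 1)) =
    inner ℂ g' (((1 / Complex.I) •
      (polyHom hV.comm (aeval affinePoint P) * polyHom hV.comm_adjoint (aeval affinePoint Q) -
      polyHom hV.comm (aeval affinePoint Q) * polyHom hV.comm_adjoint (aeval affinePoint P))) g) := by
  have hop := congrArg (fun T : H →L[ℂ] H => inner ℂ g' (((1 / Complex.I) • T) g))
    (β.operator_identity (polyHom hV.comm) (polyHom hV.comm_adjoint) affinePoint)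
  refine Eq.trans ?_ hop.symm
  have hs : ∀ (c : ℝ) (u v : H), inner ℂ u (c • v) = (c : ℂ) * inner ℂ u v := fun c u v => by
    rw [← Complex.coe_smul, inner_smul_right]
  have hsE : ∀ (c : ℝ) (u v : E), inner ℂ u (c • v) = (c : ℂ) * inner ℂ u v := fun c u v => by
    rw [← Complex.coe_smul, inner_smul_right]
  rw [PiLp.inner_apply]
  simp only [V.blownBezout_apply, Finset.smul_sum, sum_apply, inner_sum]
  refine Finset.sum_congr rfl fun i _ => Finset.sum_congr rfl fun j _ =>
    Finset.sum_congr rfl fun k _ => ?_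
  rw [hsE, smul_comm]
  have : ∀ (c : ℝ) (T : H →L[ℂ] H), (c • T) g = c • T g := fun c T => rfl
  rw [this, hs]
  congr 1
  simp only [blowUp, one_mul, hV.orbit_apply]
  rw [← hV.adjoint_polyHom (i.mono affinePoint), ← ContinuousLinearMap.adjoint_inner_right,
    ContinuousLinearMap.adjoint_inner_left]
  congr 1
  have hk := DFunLike.congr_fun (hV.adjoint_pencil k) (polyHom hV.comm_adjoint (j.mono affinePoint) g)
  simp only [ContinuousLinearMap.comp_apply] at hk
  rw [hk]
  simp only [smul_apply, mul_apply_eq_comp, map_smul]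

variable (p : Fin 3 → MvPolynomial (Fin 2) ℝ)

/-- A common form of the colligation conditions for the transform. -/
theorem VesselData.IsVessel.transform_colligation (hV : V.IsVessel)
    (hp : IsUnit (polyOp (p 0) V.A₁ V.A₂)) (f : MvPolynomial (Fin 2) ℝ)
    (β : BezoutTriple (maxDegree p) (homogenizeTo (maxDegree p) f)
      (homogenizeTo (maxDegree p) (p 0))) :
    (V.transformΦ p).adjoint ∘L V.bezout β ∘L V.transformΦ p = (1 / Complex.I) •
      (polyOp f V.A₁ V.A₂ * Ring.inverse (polyOp (p 0) V.A₁ V.A₂) -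
        (polyOp f V.A₁ V.A₂ * Ring.inverse (polyOp (p 0) V.A₁ V.A₂)).adjoint) := by
  set T := polyOp (p 0) V.A₁ V.A₂ with hT
  have hT' : polyOp (p 0) V.A₁.adjoint V.A₂.adjoint = T.adjoint := (polyOp_adjoint hV.comm _).symm
  have hinv : Ring.inverse T.adjoint = (Ring.inverse T).adjoint := Ring.inverse_star T
  ext h : 1
  refine ext_inner_left ℂ fun h' => ?_
  rw [ContinuousLinearMap.comp_apply, ContinuousLinearMap.comp_apply,
    ContinuousLinearMap.adjoint_inner_right, V.inner_bezout, hV.transformΦ_apply,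
    hV.transformΦ_apply, hV.inner_bezout_orbit, aeval_affinePoint, aeval_affinePoint, hT', hinv,
    ContinuousLinearMap.adjoint_inner_left]
  congr 1
  rw [← ContinuousLinearMap.comp_apply, ← ContinuousLinearMap.comp_apply]
  refine DFunLike.congr_fun (?_ : (_ : H →L[ℂ] H) = _) h
  -- It remains to see that `T⁻¹ (f T* - T f*) (T*)⁻¹ = f T⁻¹ - (f T⁻¹)*`, where `f` and `T`
  -- commute.
  change Ring.inverse T * (((1 / Complex.I) • _) * (Ring.inverse T).adjoint) = _
  rw [smul_mul_assoc, mul_smul_comm]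
  congr 1
  have hX0 : polyHom hV.comm (p 0) = T := polyHom_apply _ _
  rw [← hV.adjoint_polyHom, ← hV.adjoint_polyHom, hX0, ← polyHom_apply hV.comm f]
  have hc : Commute (polyHom hV.comm f) T := by
    rw [← hX0]
    exact (Commute.all f (p 0)).map (polyHom hV.comm)
  have hc' := (Commute.ringInverse_right_of_isUnit hc hp).eq
  simp only [← ContinuousLinearMap.star_eq_adjoint]
  have e1 : Ring.inverse T * T = 1 := Ring.inverse_mul_cancel _ hp
  have e2 : star T * star (Ring.inverse T) = 1 := by rw [← star_mul, e1, star_one]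
  set X' := polyHom hV.comm f
  calc Ring.inverse T * ((X' * star T - T * star X') * star (Ring.inverse T))
      = Ring.inverse T * X' * (star T * star (Ring.inverse T)) -
        (Ring.inverse T * T) * (star X' * star (Ring.inverse T)) := by noncomm_ring
    _ = X' * Ring.inverse T - star (X' * Ring.inverse T) := by
      rw [e1, e2, mul_one, one_mul, ← star_mul, hc']

/-- This is the three-term identity of `inner_blownBezout_combination` along an orbit: the factors
`p_k` act on the orbit as `p_k(A₁*, A₂*)`. -/
theorem VesselData.IsVessel.transform_input (hV : V.IsVessel)
    (hp : IsUnit (polyOp (p 0) V.A₁ V.A₂)) (β : BezoutChoice p) :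
    V.bezout β.pair12 ∘L V.transformΦ p =
      V.bezout β.pair10 ∘L V.transformΦ p ∘L (V.transform p β).A₂.adjoint -
        V.bezout β.pair20 ∘L V.transformΦ p ∘L (V.transform p β).A₁.adjoint := by
  change _ = V.bezout β.pair10 ∘L V.transformΦ p ∘L
      (polyOp (p 2) V.A₁ V.A₂ * Ring.inverse (polyOp (p 0) V.A₁ V.A₂)).adjoint -
    V.bezout β.pair20 ∘L V.transformΦ p ∘L
      (polyOp (p 1) V.A₁ V.A₂ * Ring.inverse (polyOp (p 0) V.A₁ V.A₂)).adjoint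
  set T := polyHom hV.comm_adjoint (p 0) with hT
  have hT1 : polyOp (p 0) V.A₁.adjoint V.A₂.adjoint = T := (polyHom_apply _ _).symm
  have hT2 : (polyOp (p 0) V.A₁ V.A₂).adjoint = T := by rw [← hT1, polyOp_adjoint hV.comm]
  have hu : IsUnit T := by
    rw [← hT2, ← ContinuousLinearMap.star_eq_adjoint]; exact hp.star
  have hinv : (Ring.inverse (polyOp (p 0) V.A₁ V.A₂)).adjoint = Ring.inverse T := by
    rw [← hT2]; exact (Ring.inverse_star _).symm
  have hadj : ∀ k, (polyOp (p k) V.A₁ V.A₂ * Ring.inverse (polyOp (p 0) V.A₁ V.A₂)).adjoint =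
      Ring.inverse T * polyHom hV.comm_adjoint (p k) := by
    intro k
    rw [← hinv, ← hV.adjoint_polyHom, polyHom_apply]
    exact ContinuousLinearMap.adjoint_comp _ _
  have hc : ∀ k, Commute (polyHom hV.comm_adjoint (p k)) (Ring.inverse T) := fun k =>
    Commute.ringInverse_right_of_isUnit ((Commute.all (p k) (p 0)).map (polyHom hV.comm_adjoint)) hu
  rw [hadj, hadj]
  ext h : 1
  refine ext_inner_left ℂ fun w => ?_
  -- One inverse comes from `Φ'`, the other from the adjoint of `A'_k`.
  set g := Ring.inverse T (Ring.inverse T h) with hg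
  have hΦ : ∀ k, blowUp (maxDegree p) affinePoint (hV.orbit g) (p k) =
      V.transformΦ p ((polyHom hV.comm_adjoint (p k)) (Ring.inverse T h)) := by
    intro k
    rw [hV.transformΦ_apply, hV.blowUp_orbit, hT1]
    congr 2
    exact DFunLike.congr_fun (hc k).eq (Ring.inverse T h)
  have h0 : (polyHom hV.comm_adjoint (p 0)) (Ring.inverse T h) = h :=
    DFunLike.congr_fun (Ring.mul_inverse_cancel T hu) h
  have h' : ∀ k, (Ring.inverse T * polyHom hV.comm_adjoint (p k)) h =
      (polyHom hV.comm_adjoint (p k)) (Ring.inverse T h) := fun k =>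
    (DFunLike.congr_fun (hc k).eq h).symm
  have key := V.inner_blownBezout_combination hV.selfAdjoint_σ₁ hV.selfAdjoint_σ₂ hV.selfAdjoint_γin
    (P := fun k => homogenizeTo (maxDegree p) (p k)) β.pair10 β.pair20 β.pair12 affinePoint 0 rfl
    (hV.orbit g) (hV.sum_pencil_orbit g) w w.2
  simp only [aeval_affinePoint, hΦ, h0] at key
  simp only [ContinuousLinearMap.comp_apply, sub_apply, inner_sub_right, V.inner_bezout, h']
  linear_combination key

theorem isSelfAdjoint_linkage {G : Type*} [NormedAddCommGroup G] [InnerProductSpace ℂ G]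
    [CompleteSpace G] {S₁ S₂ T : G →L[ℂ] G} (F : H →L[ℂ] G) (h₁ : IsSelfAdjoint S₁)
    (h₂ : IsSelfAdjoint S₂) (h : IsSelfAdjoint T) :
    IsSelfAdjoint (T + Complex.I • (S₁ ∘L F ∘L F.adjoint ∘L S₂ - S₂ ∘L F ∘L F.adjoint ∘L S₁)) := by
  rw [ContinuousLinearMap.isSelfAdjoint_iff'] at *
  simp only [map_smulₛₗ, map_sub, map_add, h, h₁, h₂, ContinuousLinearMap.adjoint_comp,
    ContinuousLinearMap.adjoint_adjoint, Complex.conj_I]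
  rw [neg_smul, ← smul_neg, neg_sub]
  rfl

/-- The transform `V'` is a commutative vessel. -/
theorem VesselData.IsVessel.transform (hV : V.IsVessel)
    (hp : IsUnit (polyOp (p 0) V.A₁ V.A₂)) (β : BezoutChoice p) :
    (V.transform p β).IsVessel := by
  have s10 := V.bezout_isSelfAdjoint hV.selfAdjoint_σ₁ hV.selfAdjoint_σ₂ hV.selfAdjoint_γin β.pair10
  have s20 := V.bezout_isSelfAdjoint hV.selfAdjoint_σ₁ hV.selfAdjoint_σ₂ hV.selfAdjoint_γin β.pair20
  have s12 := V.bezout_isSelfAdjoint hV.selfAdjoint_σ₁ hV.selfAdjoint_σ₂ hV.selfAdjoint_γin β.pair12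
  have c1 := hV.transform_colligation p hp (p 1) β.pair10
  have c2 := hV.transform_colligation p hp (p 2) β.pair20
  have hin := hV.transform_input p hp β
  refine ⟨?_, s10, s20, s12, ?_, c1, c2, hin, ?_, rfl⟩
  · have hc : ∀ f g : MvPolynomial (Fin 2) ℝ,
        Commute (polyOp f V.A₁ V.A₂) (polyOp g V.A₁ V.A₂) := by
      intro f g
      rw [← polyHom_apply hV.comm, ← polyHom_apply hV.comm]
      exact (Commute.all f g).map (polyHom hV.comm)
    have i1 := Commute.ringInverse_right_of_isUnit (hc (p 1) (p 0)) hp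
    have i2 := Commute.ringInverse_right_of_isUnit (hc (p 2) (p 0)) hp
    exact (((hc (p 1) (p 2)).mul_right i1).mul_left (i2.symm.mul_right (Commute.refl _))).eq
  · exact isSelfAdjoint_linkage (V.transformΦ p) s10 s20 s12
  · set S₁ := V.bezout β.pair10
    set S₂ := V.bezout β.pair20
    set F := V.transformΦ p
    set A₁' := (V.transform p β).A₁ with hA₁
    set A₂' := (V.transform p β).A₂ with hA₂
    change F.adjoint ∘L S₁ ∘L F = (1 / Complex.I) • (A₁' - A₁'.adjoint) at c1
    change F.adjoint ∘L S₂ ∘L F = (1 / Complex.I) • (A₂' - A₂'.adjoint) at c2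
    change (V.bezout β.pair12 + Complex.I • (S₁ ∘L F ∘L F.adjoint ∘L S₂ -
      S₂ ∘L F ∘L F.adjoint ∘L S₁)) ∘L F = S₁ ∘L F ∘L A₂' - S₂ ∘L F ∘L A₁'
    -- By the colligation conditions, linkage adds to `γ'ⁱⁿ Φ'` exactly the terms that replace the
    -- adjoints of `A'_k` by `A'_k`.
    ext h : 1
    have d1 := DFunLike.congr_fun c1 h
    have d2 := DFunLike.congr_fun c2 h
    have d3 := DFunLike.congr_fun hin h
    simp only [ContinuousLinearMap.comp_apply, add_apply, sub_apply, smul_apply] at d1 d2 d3 ⊢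
    rw [d1, d2, d3]
    simp only [map_smul, smul_sub, smul_smul, map_sub]
    simp only [mul_one_div, div_self Complex.I_ne_zero, one_smul]
    abel

end Transform

/-! ### Vanishing at basepoints, and the vessel `V''`. -/

section Basepoints

variable {H E : Type*} [NormedAddCommGroup H] [InnerProductSpace ℂ H] [CompleteSpace H]
  [NormedAddCommGroup E] [InnerProductSpace ℂ E] [FiniteDimensional ℂ E] [CompleteSpace E]
  {V : VesselData H E}

/-- The line `r ↦ r e` as a real linear map. -/
noncomputable def scalarLine (e : E) : ℂ →ₗ[ℝ] E := (LinearMap.toSpanSingleton ℂ E e).restrictScalars ℝ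

omit [FiniteDimensional ℂ E] [CompleteSpace E] in
theorem scalarLine_apply (e : E) (r : ℂ) : scalarLine e r = r • e := rfl

omit [CompleteSpace H] [FiniteDimensional ℂ E] [CompleteSpace E] in
theorem sum_pencil_scalarLine (V : VesselData H E) {x : Fin 3 → ℂ} {e : E}
    (h : ∑ l, x l • V.pencil l e = 0) (r : ℂ) :
    ∑ l, V.pencil l (scalarLine e (x l * r)) = 0 := by
  simp only [scalarLine_apply, mul_comm _ r, mul_smul, map_smul, ← Finset.smul_sum, h, smul_zero]

omit [FiniteDimensional ℂ E] [CompleteSpace E] in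
theorem blowUp_scalarLine (n : ℕ) (x : Fin 3 → ℂ) (e : E) (r : ℂ) :
    blowUp n x (scalarLine e) r = r • vandermondeVector n x e := by
  ext i
  simp [blowUp, vandermondeVector, scalarLine_apply, MIdx.mono, mul_smul]

omit [FiniteDimensional ℂ E] [CompleteSpace E] in
theorem vandermondeVector_smul (n : ℕ) (c : ℂ) (x : Fin 3 → ℂ) (e : E) :
    vandermondeVector n (c • x) e = c ^ (n - 1) • vandermondeVector n x e := by
  ext i
  have hi : n - 1 = i.1 0 + i.1 1 + i.1 2 := by have := i.2; omega
  simp only [vandermondeVector, PiLp.smul_apply, Pi.smul_apply, smul_eq_mul, smul_smul, hi]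
  congr 1
  ring

theorem aeval_smul_of_isHomogeneous {n : ℕ} {P : MvPolynomial (Fin 3) ℝ} (hP : P.IsHomogeneous n)
    (c : ℂ) (x : Fin 3 → ℂ) : aeval (c • x) P = c ^ n * aeval x P := by
  rw [aeval_def, aeval_def, eval₂_eq, eval₂_eq, Finset.mul_sum]
  refine Finset.sum_congr rfl fun d hd => ?_
  have h := hP (mem_support_iff.mp hd)
  have h : n = d 0 + d 1 + d 2 := by
    simpa [Finsupp.weight_apply, Finsupp.sum_fintype, Fin.sum_univ_three] using h.symm
  rw [Finset.prod_subset (Finset.subset_univ d.support), Finset.prod_subset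
    (Finset.subset_univ d.support), Fin.prod_univ_three, Fin.prod_univ_three, h]
  · simp only [Pi.smul_apply, smul_eq_mul]; ring
  · intro i _ hi; simp [Finsupp.notMem_support_iff.mp hi]
  · intro i _ hi; simp [Finsupp.notMem_support_iff.mp hi]

/-- The syzygy argument needs a coordinate equal to `1`. Rescaling `x` achieves this: it only
multiplies the Vandermonde vector and the values of `P` and `Q` by powers of the scalar. -/
theorem VesselData.IsVessel.bezout_vandermonde_eq_zero (hV : V.IsVessel) {n : ℕ}
    {P Q : MvPolynomial (Fin 3) ℝ} (hP : P.IsHomogeneous n) (hQ : Q.IsHomogeneous n)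
    (β : BezoutTriple n P Q) {x : Fin 3 → ℂ} (hx : x ≠ 0) {e : E}
    (he : ∑ l, x l • V.pencil l e = 0) (hxP : aeval x P = 0) (hxQ : aeval x Q = 0)
    (v : V.principalSubspace n) (hv : (v : BlownSpace n E) = vandermondeVector n x e) :
    V.bezout β v = 0 := by
  obtain ⟨k, hk⟩ := Function.ne_iff.mp hx
  rw [Pi.zero_apply] at hk
  set x' := (x k)⁻¹ • x with hx'
  have hxx : x = x k • x' := by rw [hx', smul_smul, mul_inv_cancel₀ hk, one_smul]
  refine ext_inner_left ℂ fun w => ?_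
  rw [V.inner_bezout, hv, hxx, vandermondeVector_smul, ← blowUp_scalarLine, inner_zero_right]
  refine V.inner_blownBezout_eq_zero hV.selfAdjoint_σ₁ hV.selfAdjoint_σ₂ hV.selfAdjoint_γin β x' k
    (by simp [hx', hk]) ?_ ?_ _ (sum_pencil_scalarLine V ?_) w w.2 _
  · rw [hx', aeval_smul_of_isHomogeneous hP, hxP, mul_zero]
  · rw [hx', aeval_smul_of_isHomogeneous hQ, hxQ, mul_zero]
  · simp only [hx', Pi.smul_apply, smul_assoc, ← Finset.smul_sum, he, smul_zero]

omit [CompleteSpace H] [CompleteSpace E] in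
theorem VesselData.reducedSpace_orthogonal (V : VesselData H E) (p : Fin 3 → MvPolynomial (Fin 2) ℝ) :
    (V.reducedSpace p)ᗮ = V.basepointSpan p :=
  Submodule.orthogonal_orthogonal _

/-- Bezout operators annihilate the complement of the reduced space. -/
theorem VesselData.IsVessel.bezout_eq_zero_of_mem (hV : V.IsVessel)
    (p : Fin 3 → MvPolynomial (Fin 2) ℝ) {k l : Fin 3}
    (β : BezoutTriple (maxDegree p) (homogenizeTo (maxDegree p) (p k))
      (homogenizeTo (maxDegree p) (p l))) :
    ∀ v ∈ (V.reducedSpace p)ᗮ, V.bezout β v = 0 := by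
  intro v hv
  rw [V.reducedSpace_orthogonal] at hv
  have : V.basepointSpan p ≤ LinearMap.ker
      (V.bezout β : V.principalSubspace (maxDegree p) →ₗ[ℂ] V.principalSubspace (maxDegree p)) := by
    refine Submodule.span_le.mpr ?_
    rintro u ⟨x, e, hx, hP, he, hu⟩
    refine hV.bezout_vandermonde_eq_zero (homogenizeTo_maxDegree_isHomogeneous p k)
      (homogenizeTo_maxDegree_isHomogeneous p l) β hx ?_ (hP k) (hP l) u hu
    rw [← he]
    simp [Fin.sum_univ_three, VesselData.pencil, sub_eq_add_neg]
  exact this hv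

/-- The compressed transform `V''` is a commutative vessel. -/
theorem VesselData.IsVessel.reducedTransform (hV : V.IsVessel) (p : Fin 3 → MvPolynomial (Fin 2) ℝ)
    (hp : IsUnit (polyOp (p 0) V.A₁ V.A₂)) (β : BezoutChoice p) :
    (V.reducedTransform p β).IsVessel :=
  (hV.transform p hp β).compress (V.reducedSpace p) (hV.bezout_eq_zero_of_mem p β.pair10)
    (hV.bezout_eq_zero_of_mem p β.pair20) (hV.bezout_eq_zero_of_mem p β.pair12)

end Basepoints

/-! ### Irreducible plane curves. -/

section Curves

/-- A polynomial vanishes on an irreducible plane curve iff it is divisible by its equation. -/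
theorem dvd_iff_eval_eq_zero {F : MvPolynomial (Fin 2) ℂ} (hF : Irreducible F)
    (f : MvPolynomial (Fin 2) ℂ) : F ∣ f ↔ ∀ y ∈ planeCurve F, eval y f = 0 := by
  constructor
  · rintro ⟨g, rfl⟩ y hy
    rw [map_mul, show eval y F = 0 from hy, zero_mul]
  · intro h
    -- A prime ideal is the vanishing ideal of its zero locus, by the Nullstellensatz.
    have hprime : (Ideal.span {F}).IsPrime :=
      (Ideal.span_singleton_prime hF.ne_zero).mpr hF.prime
    rw [← Ideal.mem_span_singleton, ← IsPrime.vanishingIdeal_zeroLocus (K := ℂ) (Ideal.span {F}),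
      mem_vanishingIdeal_iff]
    intro y hy
    have : eval y F = 0 := by
      simpa [aeval_eq_eval] using hy F (Ideal.mem_span_singleton_self F)
    simpa [aeval_eq_eval] using h y this

theorem totalDegree_pderiv_lt {F : MvPolynomial (Fin 2) ℂ} (i : Fin 2) (h : F.totalDegree ≠ 0) :
    (pderiv i F).totalDegree < F.totalDegree := by
  rw [totalDegree, Finset.sup_lt_iff (by simpa using Nat.pos_of_ne_zero h)]
  intro d hd
  rw [mem_support_iff, coeff_pderiv] at hd
  have h1 : d + Finsupp.single i 1 ∈ F.support := by
    rw [mem_support_iff]; intro h0; rw [h0] at hd; simp at hd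
  have := le_totalDegree h1
  rw [Finsupp.sum_fintype _ _ (by simp), Fin.sum_univ_two] at this ⊢
  fin_cases i <;> simp at this ⊢ <;> omega

theorem Irreducible.totalDegree_ne_zero {F : MvPolynomial (Fin 2) ℂ} (hF : Irreducible F) :
    F.totalDegree ≠ 0 := by
  intro h
  rw [totalDegree_eq_zero_iff_eq_C] at h
  by_cases h0 : coeff 0 F = 0
  · rw [h0, map_zero] at h
    exact hF.ne_zero h
  · exact hF.not_isUnit (by rw [h]; exact (Ne.isUnit h0).map C)

/-- The curve of an irreducible polynomial has a smooth point. -/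
theorem exists_not_dvd_pderiv {F : MvPolynomial (Fin 2) ℂ} (hF : Irreducible F) :
    ∃ i, ¬ F ∣ pderiv i F := by
  by_contra! h
  -- A multiple of `F` of smaller degree is zero; in characteristic zero, vanishing partial
  -- derivatives make `F` constant.
  have hzero : ∀ i, pderiv i F = 0 := by
    intro i
    by_contra h0
    obtain ⟨g, hg⟩ := h i
    have h1 := totalDegree_pderiv_lt i hF.totalDegree_ne_zero
    have hg0 : g ≠ 0 := by rintro rfl; exact h0 (by rw [hg, mul_zero])
    rw [hg, totalDegree_mul_of_isDomain hF.ne_zero hg0] at h1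
    omega
  apply hF.totalDegree_ne_zero
  rw [totalDegree_eq_zero_iff]
  intro d hd i
  by_contra hdi
  have h1 := congrArg (coeff (d - Finsupp.single i 1)) (hzero i)
  have h2 : d - Finsupp.single i 1 + Finsupp.single i 1 = d := by
    ext j
    by_cases hj : j = i
    · subst hj; simp; omega
    · simp [Ne.symm hj]
  rw [coeff_pderiv, h2, coeff_zero] at h1
  rcases mul_eq_zero.mp h1 with h | h
  · exact mem_support_iff.mp hd h
  · exact Nat.cast_add_one_ne_zero _ h

/-- An irreducible plane curve is not a point. -/
theorem not_dvd_X_sub_C {F : MvPolynomial (Fin 2) ℂ} (hF : Irreducible F) (y : Fin 2 → ℂ) :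
    ∃ i, ¬ F ∣ X i - C (y i) := by
  by_contra! h
  obtain ⟨g, hg⟩ := h 0
  have hX : (X 0 - C (y 0) : MvPolynomial (Fin 2) ℂ) ≠ 0 := by
    intro h0
    have := congrArg (eval ![y 0 + 1, 0]) h0
    simp at this
  have hg0 : g ≠ 0 := by rintro rfl; exact hX (by rw [hg, mul_zero])
  have hdeg : (X 0 - C (y 0) : MvPolynomial (Fin 2) ℂ).totalDegree ≤ 1 := by
    refine (totalDegree_sub _ _).trans ?_
    simp
  rw [hg, totalDegree_mul_of_isDomain hF.ne_zero hg0] at hdeg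
  have h1 := hF.totalDegree_ne_zero
  have hg1 : g.totalDegree = 0 := by omega
  rw [totalDegree_eq_zero_iff_eq_C] at hg1
  have hc : coeff 0 g ≠ 0 := by
    intro h0; rw [h0, map_zero] at hg1; exact hg0 hg1
  -- By degrees `F` is a scalar multiple of `X 0 - C (y 0)`, so the curve is a whole line, on which
  -- `X 1 - C (y 1)` does not vanish.
  have hmem : ![y 0, y 1 + 1] ∈ planeCurve F := by
    have := congrArg (eval ![y 0, y 1 + 1]) hg
    rw [hg1] at this
    simp only [map_sub, eval_X, Matrix.cons_val_zero, eval_C, sub_self, map_mul] at this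
    exact (mul_eq_zero.mp this.symm).resolve_right hc
  have := (dvd_iff_eval_eq_zero hF _).mp (h 1) _ hmem
  simp at this

/-- Clearing denominators in the composition with a rational map. -/
theorem PlaneRationalMap.exists_eval_eq (f : PlaneRationalMap) (h : MvPolynomial (Fin 2) ℂ) :
    ∃ (G : MvPolynomial (Fin 2) ℂ) (N : ℕ), ∀ y, eval y f.den ≠ 0 →
      eval y G = eval y f.den ^ N * eval (f.app y) h := by
  refine ⟨∑ d ∈ h.support, C (coeff d h) * (f.den ^ (h.totalDegree - (d 0 + d 1)) *
    f.num₁ ^ d 0 * f.num₂ ^ d 1), h.totalDegree, fun y hy => ?_⟩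
  rw [eval_eq' (f.app y) h, map_sum, Finset.mul_sum]
  refine Finset.sum_congr rfl fun d hd => ?_
  have hd' : d 0 + d 1 ≤ h.totalDegree := by
    have := le_totalDegree hd
    rwa [Finsupp.sum_fintype _ _ (by simp), Fin.sum_univ_two] at this
  obtain ⟨m, hm⟩ := Nat.exists_eq_add_of_le hd'
  rw [hm, Nat.add_sub_cancel_left]
  simp only [map_mul, map_pow, eval_C, PlaneRationalMap.app, Fin.prod_univ_two,
    Matrix.cons_val_zero, Matrix.cons_val_one]
  rw [div_pow, div_pow, pow_add, pow_add]
  field_simp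

end Curves

/-! ### Jacobi's formula. -/

section Determinant

theorem Derivation.map_prod {A : Type*} [CommRing A] {R : Type*} [CommRing R] [Algebra R A]
    (D : Derivation R A A) {ι : Type*} [DecidableEq ι] (s : Finset ι) (f : ι → A) :
    D (∏ i ∈ s, f i) = ∑ i ∈ s, D (f i) * ∏ j ∈ s.erase i, f j := by
  induction s using Finset.induction_on with
  | empty => simp
  | insert a s ha ih =>
    rw [Finset.prod_insert ha, D.leibniz, ih, Finset.sum_insert ha, Finset.erase_insert ha,
      smul_eq_mul, smul_eq_mul, Finset.mul_sum, add_comm]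
    congr 1
    · ring
    · refine Finset.sum_congr rfl fun i hi => ?_
      rw [Finset.erase_insert_of_ne (by rintro rfl; exact ha hi), Finset.prod_insert (by simp [ha])]
      ring

/-- Jacobi's formula for the derivative of a determinant. -/
theorem Derivation.map_det {A : Type*} [CommRing A] {R : Type*} [CommRing R] [Algebra R A]
    (D : Derivation R A A) {m : Type*} [Fintype m] [DecidableEq m] (M : Matrix m m A) :
    D M.det = (M.adjugate * M.map D).trace := by
  -- By Cramer's rule each diagonal entry is the determinant with one column differentiated.
  have h1 : (M.adjugate * M.map D).trace = ∑ i, (M.updateCol i fun j => D (M j i)).det := by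
    refine Finset.sum_congr rfl fun i _ => ?_
    rw [← Matrix.cramer_apply, Matrix.cramer_eq_adjugate_mulVec]
    rfl
  rw [h1, Matrix.det_apply, map_sum]
  simp only [Matrix.det_apply]
  rw [Finset.sum_comm]
  refine Finset.sum_congr rfl fun σ _ => ?_
  rw [← Finset.smul_sum]
  have h2 : ∀ (u : ℤˣ) (a : A), D (u • a) = u • D a := by
    intro u a
    rcases Int.units_eq_one_or u with rfl | rfl <;> simp
  rw [h2, D.map_prod]
  congr 1
  refine Finset.sum_congr rfl fun i _ => ?_
  rw [← Finset.mul_prod_erase _ _ (Finset.mem_univ i)]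
  congr 1
  · simp
  · refine Finset.prod_congr rfl fun j hj => ?_
    rw [Matrix.updateCol_ne (Finset.ne_of_mem_erase hj)]

/-- `adj M * N` squares to zero, and nilpotent matrices have trace zero. By Jacobi's formula this
trace is the derivative of the determinant in the direction `N`. -/
theorem trace_adjugate_mul_eq_zero {m : Type*} [Fintype m] [DecidableEq m] {M N : Matrix m m ℂ}
    (h : M.adjugate * N * M.adjugate = 0) : (M.adjugate * N).trace = 0 := by
  refine (Matrix.isNilpotent_trace_of_isNilpotent ⟨2, ?_⟩).eq_zero
  rw [pow_two, ← mul_assoc, h, zero_mul]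

end Determinant

/-! ### Vandermonde vectors at two points of the curve, and the gradient of `Δ`. -/

section Geometry

variable {H E : Type*} [NormedAddCommGroup H] [InnerProductSpace ℂ H]
  [NormedAddCommGroup E] [InnerProductSpace ℂ E]

/-- The homogeneous coordinates `(1, y₁, y₂)`. -/
def homPoint (y : Fin 2 → ℂ) : Fin 3 → ℂ := ![1, y 0, y 1]

/-- The pencil `y₁ σ₂ - y₂ σ₁ + γⁱⁿ` at a point of the affine plane. -/
def VesselData.affinePencil (V : VesselData H E) (y : Fin 2 → ℂ) : E →L[ℂ] E :=
  y 0 • V.σ₂ - y 1 • V.σ₁ + V.γin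

theorem VesselData.sum_homPoint_smul_pencil (V : VesselData H E) (y : Fin 2 → ℂ) (e : E) :
    ∑ l, homPoint y l • V.pencil l e = V.affinePencil y e := by
  simp [Fin.sum_univ_three, homPoint, VesselData.pencil, VesselData.affinePencil]
  abel

theorem aeval_homPoint (y : Fin 2 → ℂ) (n : ℕ) (p : MvPolynomial (Fin 2) ℝ) :
    aeval (homPoint y) (homogenizeTo n p) = aeval y p := aeval_homogenizeTo y n p

/-- Pairing of Vandermonde vectors through a Bezout operator. -/
theorem VesselData.inner_blownBezout_vandermonde (V : VesselData H E) {n : ℕ}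
    {P Q : MvPolynomial (Fin 3) ℝ} (β : BezoutTriple n P Q) (x z : Fin 3 → ℂ) (e f : E) (κ : ℂ)
    (hκ : ∀ l, inner ℂ f (V.pencil l e) = κ * (z (l + 1) * x (l + 2) - z (l + 2) * x (l + 1))) :
    inner ℂ (vandermondeVector n (fun k => starRingEnd ℂ (z k)) f)
      (V.blownBezout β (vandermondeVector n x e)) =
      κ * (aeval z P * aeval x Q - aeval z Q * aeval x P) := by
  rw [β.aeval_identity z x, PiLp.inner_apply, Finset.mul_sum]
  refine Finset.sum_congr rfl fun i _ => ?_
  rw [V.blownBezout_apply, inner_sum, Finset.mul_sum]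
  refine Finset.sum_congr rfl fun j _ => ?_
  rw [inner_sum, Finset.mul_sum, Finset.sum_mul, Finset.mul_sum]
  refine Finset.sum_congr rfl fun k _ => ?_
  rw [← Complex.coe_smul, inner_smul_right]
  simp only [vandermondeVector, map_smul, inner_smul_left, inner_smul_right, hκ, MIdx.mono,
    map_mul, map_pow, Complex.conj_conj, Complex.coe_algebraMap]
  ring

/-- A vector orthogonal to two distinct points of the affine plane is a multiple of their cross
product. -/
theorem exists_eq_mul_cross {y z : Fin 2 → ℂ} (hyz : z ≠ y) {c : Fin 3 → ℂ}
    (hy : ∑ l, homPoint y l * c l = 0) (hz : ∑ l, homPoint z l * c l = 0) :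
    ∃ κ, ∀ l, c l = κ * (homPoint z (l + 1) * homPoint y (l + 2) -
      homPoint z (l + 2) * homPoint y (l + 1)) := by
  simp only [Fin.sum_univ_three, homPoint, Matrix.cons_val_zero, Matrix.cons_val_one,
    Matrix.cons_val, one_mul] at hy hz
  have h3 : ∀ κ, c 0 = κ * (z 0 * y 1 - z 1 * y 0) → c 1 = κ * (z 1 * 1 - 1 * y 1) →
      c 2 = κ * (1 * y 0 - z 0 * 1) → ∀ l, c l = κ * (homPoint z (l + 1) * homPoint y (l + 2) -
      homPoint z (l + 2) * homPoint y (l + 1)) := by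
    intro κ h0 h1 h2 l
    fin_cases l
    · exact h0
    · exact h1
    · exact h2
  by_cases h : z 1 = y 1
  · have h0 : y 0 - z 0 ≠ 0 := by
      intro h0
      apply hyz
      ext k
      fin_cases k
      · exact (sub_eq_zero.mp h0).symm
      · exact h
    have e1 : c 1 = 0 := by
      have : (y 0 - z 0) * c 1 = 0 := by rw [h] at hz; linear_combination hy - hz
      exact (mul_eq_zero.mp this).resolve_left h0
    refine ⟨c 2 / (y 0 - z 0), h3 _ ?_ ?_ ?_⟩
    · rw [e1] at hy
      rw [h]
      field_simp
      linear_combination (y 0 - z 0) * hy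
    · rw [e1, h]; ring
    · field_simp
  · have h0 : z 1 - y 1 ≠ 0 := sub_ne_zero.mpr h
    have e2 : c 2 = c 1 / (z 1 - y 1) * (1 * y 0 - z 0 * 1) := by
      field_simp
      linear_combination hz - hy
    refine ⟨c 1 / (z 1 - y 1), h3 _ ?_ ?_ e2⟩
    · have e0 : c 0 = -(y 0 * c 1 + y 1 * c 2) := by linear_combination hy
      rw [e0, e2]
      field_simp
      ring
    · field_simp

variable [CompleteSpace H] [FiniteDimensional ℂ E] [CompleteSpace E]

-- Hence a vector orthogonal to the range of the pencil at `z` lies in the kernel of the pencil at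
-- the conjugate point; this is why Vandermonde vectors at conjugate points appear in the pairing.
omit [CompleteSpace H] [FiniteDimensional ℂ E] in
theorem VesselData.inner_affinePencil (V : VesselData H E)
    (h1 : IsSelfAdjoint V.σ₁) (h2 : IsSelfAdjoint V.σ₂) (h3 : IsSelfAdjoint V.γin)
    (z : Fin 2 → ℂ) (f u : E) :
    inner ℂ (∑ l, starRingEnd ℂ (homPoint z l) • V.pencil l f) u =
      inner ℂ f (V.affinePencil z u) := by
  rw [← V.sum_homPoint_smul_pencil, sum_inner, inner_sum]
  refine Finset.sum_congr rfl fun l _ => ?_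
  rw [inner_smul_left, inner_smul_right, Complex.conj_conj, V.pencil_symm h1 h2 h3]

/-- If a Vandermonde vector at `y` is annihilated by the Bezout operators, then `e` is orthogonal to
the cokernels of the pencil at the points `z` that the transformation separates from `y`. -/
theorem VesselData.IsVessel.inner_pencil_eq_zero {V : VesselData H E} (hV : V.IsVessel)
    {p : Fin 3 → MvPolynomial (Fin 2) ℝ} (β : BezoutChoice p) {y z : Fin 2 → ℂ} (hyz : z ≠ y)
    (hsep : ¬ (aeval z (p 1) * aeval y (p 0) = aeval z (p 0) * aeval y (p 1) ∧
      aeval z (p 2) * aeval y (p 0) = aeval z (p 0) * aeval y (p 2)))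
    {e f : E} (he : V.affinePencil y e = 0) (hf : ∀ u, inner ℂ f (V.affinePencil z u) = 0)
    {v : V.transformSpace p} (hv : v ∈ (V.reducedSpace p)ᗮ)
    (hve : (v : BlownSpace (maxDegree p) E) = vandermondeVector (maxDegree p) (homPoint y) e)
    (l : Fin 3) : inner ℂ f (V.pencil l e) = 0 := by
  have hf' : ∑ l, starRingEnd ℂ (homPoint z l) • V.pencil l f = 0 := by
    refine ext_inner_right ℂ fun u => ?_
    rw [V.inner_affinePencil hV.selfAdjoint_σ₁ hV.selfAdjoint_σ₂ hV.selfAdjoint_γin, hf,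
      inner_zero_left]
  -- The numbers `⟨f, s_l e⟩` are annihilated by `y`, since `e` is in the kernel there, and by `z`,
  -- since `f` is in the cokernel there.
  obtain ⟨κ, hκ⟩ := exists_eq_mul_cross hyz (c := fun l => inner ℂ f (V.pencil l e)) (by
      have := congrArg (inner ℂ f) (V.sum_homPoint_smul_pencil y e)
      rw [he, inner_zero_right, inner_sum] at this
      simpa only [inner_smul_right] using this) (by
      have := hf e
      rw [← V.sum_homPoint_smul_pencil, inner_sum] at this
      simpa only [inner_smul_right] using this)
  have hpair : ∀ {k m : Fin 3} (b : BezoutTriple (maxDegree p) (homogenizeTo (maxDegree p) (p k))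
      (homogenizeTo (maxDegree p) (p m))),
      κ * (aeval z (p k) * aeval y (p m) - aeval z (p m) * aeval y (p k)) = 0 := by
    intro k m b
    have h := V.inner_blownBezout_vandermonde b (homPoint y) (homPoint z) e f κ hκ
    simp only [aeval_homPoint] at h
    rw [← h]
    let w : V.principalSubspace (maxDegree p) :=
      ⟨vandermondeVector (maxDegree p) (fun k => starRingEnd ℂ (homPoint z k)) f, by
        have := blowUp_mem_principalSubspace V (maxDegree p) _ (scalarLine f)
          (sum_pencil_scalarLine V hf') 1
        rwa [blowUp_scalarLine, one_smul] at this⟩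
    have h0 := congrArg (inner ℂ w) (hV.bezout_eq_zero_of_mem p b v hv)
    rw [V.inner_bezout, hve, inner_zero_right] at h0
    exact h0
  have hκ0 : κ = 0 := by
    by_contra hne
    exact hsep ⟨sub_eq_zero.mp ((mul_eq_zero.mp (hpair β.pair10)).resolve_left hne),
      sub_eq_zero.mp ((mul_eq_zero.mp (hpair β.pair20)).resolve_left hne)⟩
  rw [hκ l, hκ0, zero_mul]

/-- The matrix of an operator in the basis that defines the discriminant polynomial. -/
noncomputable def stdMatrix (T : E →L[ℂ] E) :
    Matrix (Fin (Module.finrank ℂ E)) (Fin (Module.finrank ℂ E)) ℂ :=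
  LinearMap.toMatrix (Module.finBasis ℂ E) (Module.finBasis ℂ E) (T : E →ₗ[ℂ] E)

/-- The polynomial matrix whose determinant is the discriminant polynomial. -/
noncomputable def VesselData.pencilMatrix (V : VesselData H E) :
    Matrix (Fin (Module.finrank ℂ E)) (Fin (Module.finrank ℂ E)) (MvPolynomial (Fin 2) ℂ) :=
  (X 0 : MvPolynomial (Fin 2) ℂ) • (stdMatrix V.σ₂).map C -
    (X 1 : MvPolynomial (Fin 2) ℂ) • (stdMatrix V.σ₁).map C + (stdMatrix V.γin).map C

omit [CompleteSpace H] [CompleteSpace E] in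
theorem VesselData.det_pencilMatrix (V : VesselData H E) :
    V.pencilMatrix.det = V.discriminantPolynomial := rfl

omit [CompleteSpace H] [CompleteSpace E] in
theorem VesselData.pencilMatrix_map_eval (V : VesselData H E) (z : Fin 2 → ℂ) :
    V.pencilMatrix.map (eval z) = stdMatrix (V.affinePencil z) := by
  ext i j
  simp [VesselData.pencilMatrix, VesselData.affinePencil, stdMatrix, Matrix.map_apply]

omit [CompleteSpace H] [CompleteSpace E] in
theorem VesselData.det_stdMatrix_affinePencil (V : VesselData H E) (z : Fin 2 → ℂ) :
    (stdMatrix (V.affinePencil z)).det = eval z V.discriminantPolynomial := by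
  rw [← V.pencilMatrix_map_eval, ← V.det_pencilMatrix, RingHom.map_det]
  rfl

omit [CompleteSpace H] [CompleteSpace E] in
theorem VesselData.eval_pderiv_discriminantPolynomial (V : VesselData H E) (i : Fin 2)
    (y : Fin 2 → ℂ) : eval y (pderiv i V.discriminantPolynomial) =
      ((stdMatrix (V.affinePencil y)).adjugate * stdMatrix (V.pencil i.succ)).trace := by
  have h : V.pencilMatrix.map (pderiv i) = (stdMatrix (V.pencil i.succ)).map C := by
    ext k l : 2
    fin_cases i <;>
      simp [VesselData.pencilMatrix, VesselData.pencil, Matrix.map_apply, pderiv_X, stdMatrix]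
  rw [← V.det_pencilMatrix, Derivation.map_det, h, ← V.pencilMatrix_map_eval]
  have h2 : (V.pencilMatrix.map (eval y)).adjugate = V.pencilMatrix.adjugate.map (eval y) :=
    (RingHom.map_adjugate (eval y) V.pencilMatrix).symm
  rw [h2, Matrix.trace, map_sum]
  refine Finset.sum_congr rfl fun k _ => ?_
  simp [Matrix.mul_apply]

omit [CompleteSpace E] in
theorem stdMatrix_mulVec (T : E →L[ℂ] E) (u : E) :
    (stdMatrix T).mulVec ((Module.finBasis ℂ E).repr u) = (Module.finBasis ℂ E).repr (T u) :=
  LinearMap.toMatrix_mulVec_repr _ _ _ _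

/-- At a point `y` of the curve that the transformation separates from the other points and where
all the Vandermonde vectors lie in the span of those at the basepoints, the gradient of the
discriminant polynomial vanishes. -/
theorem VesselData.IsVessel.eval_pderiv_eq_zero {V : VesselData H E} (hV : V.IsVessel)
    (hΔ : Irreducible V.discriminantPolynomial)
    {p : Fin 3 → MvPolynomial (Fin 2) ℝ} (β : BezoutChoice p)
    (hp0 : ¬ V.discriminantPolynomial ∣ map (algebraMap ℝ ℂ) (p 0))
    {y : Fin 2 → ℂ} (hy : y ∈ V.discriminantVariety)
    (hsep : ∀ z ∈ V.discriminantVariety, aeval z (p 0) ≠ 0 → z ≠ y →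
      ¬ (aeval z (p 1) * aeval y (p 0) = aeval z (p 0) * aeval y (p 1) ∧
        aeval z (p 2) * aeval y (p 0) = aeval z (p 0) * aeval y (p 2)))
    (hker : ∀ e, V.affinePencil y e = 0 → ∃ v ∈ (V.reducedSpace p)ᗮ,
      (v : BlownSpace (maxDegree p) E) = vandermondeVector (maxDegree p) (homPoint y) e)
    (i : Fin 2) : eval y (pderiv i V.discriminantPolynomial) = 0 := by
  rw [V.eval_pderiv_discriminantPolynomial]
  apply trace_adjugate_mul_eq_zero
  set b := Module.finBasis ℂ E with hb
  have hvan : ∀ e, V.affinePencil y e = 0 → ∀ k, ((stdMatrix (V.affinePencil y)).adjugate.mulVec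
      (b.repr (V.pencil i.succ e))) k = 0 := by
    intro e he k
    obtain ⟨v, hv, hve⟩ := hker e he
    set G : MvPolynomial (Fin 2) ℂ :=
      V.pencilMatrix.adjugate.mulVec (fun m => C (b.repr (V.pencil i.succ e) m)) k with hG
    have hGz : ∀ z, eval z G = ((stdMatrix (V.affinePencil z)).adjugate.mulVec
        (b.repr (V.pencil i.succ e))) k := by
      intro z
      have h2 : (V.pencilMatrix.map (eval z)).adjugate = V.pencilMatrix.adjugate.map (eval z) :=
        (RingHom.map_adjugate (eval z) V.pencilMatrix).symm
      rw [← V.pencilMatrix_map_eval, h2, hG]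
      simp [Matrix.mulVec, dotProduct]
    rw [← hGz]
    obtain ⟨a, ha⟩ := not_dvd_X_sub_C hΔ y
    -- The two extra factors absorb the points where the pairing says nothing, namely `p₀(z) = 0`
    -- and `z = y`; primality then removes them.
    have hdvd : V.discriminantPolynomial ∣ G * map (algebraMap ℝ ℂ) (p 0) * (X a - C (y a)) := by
      rw [dvd_iff_eval_eq_zero hΔ]
      intro z hz
      rw [map_mul, map_mul]
      by_cases hz0 : aeval z (p 0) = 0
      · have : eval z (map (algebraMap ℝ ℂ) (p 0)) = 0 := by rw [eval_map]; exact hz0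
        rw [this]; ring
      by_cases hzy : z = y
      · simp [hzy]
      -- A row of the adjugate at `z` annihilates the range of the pencil, because `adj M * M = det
      -- M = 0` there; its Riesz vector serves as `f`.
      let ψ : E →L[ℂ] ℂ := LinearMap.toContinuousLinearMap
        (LinearMap.proj k ∘ₗ (stdMatrix (V.affinePencil z)).adjugate.mulVecLin ∘ₗ
          (b.equivFun : E →ₗ[ℂ] _))
      have hψ : ∀ u, ψ u = ((stdMatrix (V.affinePencil z)).adjugate.mulVec (b.repr u)) k :=
        fun u => rfl
      have hψ' : ∀ u, inner ℂ ((InnerProductSpace.toDual ℂ E).symm ψ) u = ψ u :=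
        fun u => InnerProductSpace.toDual_symm_apply
      have := hV.inner_pencil_eq_zero β hzy (hsep z hz hz0 hzy) he
        (f := (InnerProductSpace.toDual ℂ E).symm ψ) (by
          intro u
          rw [hψ', hψ, ← stdMatrix_mulVec, Matrix.mulVec_mulVec, Matrix.adjugate_mul,
            V.det_stdMatrix_affinePencil, show eval z V.discriminantPolynomial = 0 from hz]
          simp) hv hve i.succ
      rw [hψ', hψ, ← hGz] at this
      rw [this]; ring
    have hG0 : V.discriminantPolynomial ∣ G := by
      rcases hΔ.prime.dvd_or_dvd hdvd with h | h
      · exact (hΔ.prime.dvd_or_dvd h).resolve_right hp0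
      · exact absurd h ha
    exact (dvd_iff_eval_eq_zero hΔ G).mp hG0 y hy
  ext k m
  set A := (stdMatrix (V.affinePencil y)).adjugate with hA
  -- The columns of the adjugate at `y` lie in the kernel, because `M * adj M = 0`.
  let e : E := b.equivFun.symm (A.col m)
  have hrep : (b.repr e : Fin _ → ℂ) = A.col m := b.equivFun.apply_symm_apply _
  have he : V.affinePencil y e = 0 := by
    apply b.repr.injective
    apply DFunLike.coe_injective
    rw [hb, ← stdMatrix_mulVec, ← hb, hrep, map_zero]
    have h0 : stdMatrix (V.affinePencil y) * A = 0 := by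
      rw [hA, Matrix.mul_adjugate, V.det_stdMatrix_affinePencil,
        show eval y V.discriminantPolynomial = 0 from hy, zero_smul]
    ext i
    exact congrFun (congrFun h0 i) m
  have h := hvan e he k
  rw [hb, ← stdMatrix_mulVec, ← hb, hrep, Matrix.mulVec_mulVec] at h
  exact h

end Geometry

/-! ### The image curve lies in the new discriminant variety. -/

section Main

variable {H E : Type*} [NormedAddCommGroup H] [InnerProductSpace ℂ H] [CompleteSpace H]
  [NormedAddCommGroup E] [InnerProductSpace ℂ E] [FiniteDimensional ℂ E] [CompleteSpace E]

theorem eval_map_algebraMap (y : Fin 2 → ℂ) (p : MvPolynomial (Fin 2) ℝ) :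
    eval y (map (algebraMap ℝ ℂ) p) = aeval y p := by
  rw [eval_map]; rfl

omit [CompleteSpace H] [CompleteSpace E] in
theorem VesselData.mem_discriminantVariety_of_kernel (V : VesselData H E) {y : Fin 2 → ℂ} {e : E}
    (he0 : e ≠ 0) (he : V.affinePencil y e = 0) : y ∈ V.discriminantVariety := by
  change eval y V.discriminantPolynomial = 0
  rw [V.eval_discriminantPolynomial]
  have hker : LinearMap.ker (V.affinePencil y : E →ₗ[ℂ] E) ≠ ⊥ := fun h =>
    he0 ((LinearMap.ker_eq_bot'.mp h) e he)
  exact LinearMap.det_eq_zero_iff_ker_ne_bot.mpr hker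

/-- A Vandermonde vector at `y` not spanned by those at the basepoints yields a point of the
discriminant variety of the transform. -/
theorem VesselData.IsVessel.app_mem_discriminantVariety {V : VesselData H E} (hV : V.IsVessel)
    {p : Fin 3 → MvPolynomial (Fin 2) ℝ} (β : BezoutChoice p) {y : Fin 2 → ℂ}
    (hy0 : aeval y (p 0) ≠ 0) {e : E} (he : V.affinePencil y e = 0)
    {v : V.transformSpace p} (hv : v ∉ (V.reducedSpace p)ᗮ)
    (hve : (v : BlownSpace (maxDegree p) E) = vandermondeVector (maxDegree p) (homPoint y) e) :
    (realRationalMap p).app y ∈ (V.reducedTransform p β).discriminantVariety := by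
  set K := V.reducedSpace p with hK
  have hτ := sum_pencil_scalarLine V (x := homPoint y) (e := e)
    (by rw [V.sum_homPoint_smul_pencil, he])
  -- Divided by `p₀(y)`, this says that the pencil of `V'` at `r(y)` annihilates `v`.
  have hcomb : aeval y (p 0) • V.bezout β.pair12 v + aeval y (p 1) • V.bezout β.pair20 v -
      aeval y (p 2) • V.bezout β.pair10 v = 0 := by
    refine ext_inner_left ℂ fun w => ?_
    have key := V.inner_blownBezout_combination hV.selfAdjoint_σ₁ hV.selfAdjoint_σ₂
      hV.selfAdjoint_γin (P := fun k => homogenizeTo (maxDegree p) (p k)) β.pair10 β.pair20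
      β.pair12 (homPoint y) 0 rfl (scalarLine e) hτ w w.2
    simp only [aeval_homPoint, blowUp_scalarLine, map_smul, inner_smul_right, ← hve] at key
    rw [inner_sub_right, inner_add_right, V.inner_smul_bezout, V.inner_smul_bezout,
      V.inner_smul_bezout, inner_zero_right]
    exact key
  have hsub : ∀ {k l : Fin 3} (b : BezoutTriple (maxDegree p) (homogenizeTo (maxDegree p) (p k))
      (homogenizeTo (maxDegree p) (p l))), V.bezout b (K.starProjection v) = V.bezout b v := by
    intro k l b
    have := hV.bezout_eq_zero_of_mem p b _ (K.sub_starProjection_mem_orthogonal v)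
    rw [map_sub, sub_eq_zero] at this
    exact this.symm
  refine (V.reducedTransform p β).mem_discriminantVariety_of_kernel
    (e := K.orthogonalProjectionOnto v) ?_ ?_
  · intro h0
    exact hv (K.orthogonalProjectionOnto_eq_zero_iff.mp h0)
  · have hval : (V.reducedTransform p β).affinePencil ((realRationalMap p).app y)
        (K.orthogonalProjectionOnto v) = K.orthogonalProjectionOnto
          ((aeval y (p 1) / aeval y (p 0)) • V.bezout β.pair20 (K.starProjection v) -
          (aeval y (p 2) / aeval y (p 0)) • V.bezout β.pair10 (K.starProjection v) +
          V.bezout β.pair12 (K.starProjection v)) := by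
      rw [map_add, map_sub, map_smul, map_smul, ← eval_map_algebraMap, ← eval_map_algebraMap,
        ← eval_map_algebraMap]
      rfl
    rw [hval, hsub, hsub, hsub]
    have : (aeval y (p 1) / aeval y (p 0)) • V.bezout β.pair20 v -
          (aeval y (p 2) / aeval y (p 0)) • V.bezout β.pair10 v + V.bezout β.pair12 v =
        (aeval y (p 0))⁻¹ • (aeval y (p 0) • V.bezout β.pair12 v +
          aeval y (p 1) • V.bezout β.pair20 v - aeval y (p 2) • V.bezout β.pair10 v) := by
      rw [smul_sub, smul_add, smul_smul, smul_smul, smul_smul, inv_mul_cancel₀ hy0, one_smul,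
        div_eq_inv_mul, div_eq_inv_mul]
      abel
    rw [this, hcomb, smul_zero, map_zero]

/-- The image curve lies in the discriminant variety of the transform. -/
theorem VesselData.IsVessel.planeCurve_subset_discriminantVariety {V : VesselData H E}
    (hV : V.IsVessel) (hΔ : Irreducible V.discriminantPolynomial)
    {p : Fin 3 → MvPolynomial (Fin 2) ℝ} (β : BezoutChoice p)
    {Δ' : MvPolynomial (Fin 2) ℂ} (hΔ' : Irreducible Δ')
    (hr : (realRationalMap p).IsBirationalIso V.discriminantVariety (planeCurve Δ')) :
    planeCurve Δ' ⊆ (V.reducedTransform p β).discriminantVariety := by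
  obtain ⟨⟨⟨y₀, hy₀, hy₀d⟩, hmap⟩, g, ⟨⟨t₀, ht₀, ht₀d⟩, hgmap⟩, ⟨⟨y₁, hy₁, hy₁d, hy₁g⟩, hgr⟩,
    ⟨⟨t₁, ht₁, ht₁g, ht₁d⟩, hrg⟩⟩ := hr
  set r := realRationalMap p with hrdef
  have hden : ∀ y, eval y r.den = aeval y (p 0) := fun y => eval_map_algebraMap y (p 0)
  have hp0 : ¬ V.discriminantPolynomial ∣ r.den := fun h =>
    hy₀d ((dvd_iff_eval_eq_zero hΔ _).mp h y₀ hy₀)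
  set Δ'' := (V.reducedTransform p β).discriminantPolynomial with hΔ''
  obtain ⟨i, hi⟩ := exists_not_dvd_pderiv hΔ
  -- Generic points: `r` and then its inverse are defined, and the partial derivative `i` of `Δ`
  -- does not vanish, so the gradient argument gives a contradiction if `r(y)` is missed.
  have hgen : ∀ y ∈ V.discriminantVariety, eval y r.den ≠ 0 → eval (r.app y) g.den ≠ 0 →
      eval y (pderiv i V.discriminantPolynomial) ≠ 0 → eval (r.app y) Δ'' = 0 := by
    intro y hy hyd hyg hyi
    have hy0 : aeval y (p 0) ≠ 0 := by rwa [← hden]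
    by_contra hne
    refine hyi (hV.eval_pderiv_eq_zero hΔ β hp0 hy ?_ ?_ i)
    · rintro z hz hz0 hzy ⟨h1, h2⟩
      have happ : r.app z = r.app y := by
        have e1 : aeval z (p 1) / aeval z (p 0) = aeval y (p 1) / aeval y (p 0) := by
          rw [div_eq_div_iff hz0 hy0, h1, mul_comm]
        have e2 : aeval z (p 2) / aeval z (p 0) = aeval y (p 2) / aeval y (p 0) := by
          rw [div_eq_div_iff hz0 hy0, h2, mul_comm]
        rw [← eval_map_algebraMap, ← eval_map_algebraMap, ← eval_map_algebraMap,
          ← eval_map_algebraMap] at e1 e2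
        exact congrArg₂ (fun a b : ℂ => ![a, b]) e1 e2
      have hzd : eval z r.den ≠ 0 := by rwa [hden]
      apply hzy
      rw [← hgr z hz hzd (by rwa [happ]), happ, hgr y hy hyd hyg]
    · intro e he
      have hmem := blowUp_mem_principalSubspace V (maxDegree p) _ (scalarLine e)
        (sum_pencil_scalarLine V (x := homPoint y) (by rw [V.sum_homPoint_smul_pencil, he])) 1
      rw [blowUp_scalarLine, one_smul] at hmem
      refine ⟨⟨_, hmem⟩, ?_, rfl⟩
      by_contra hv
      exact hne (hV.app_mem_discriminantVariety β hy0 he hv rfl)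
  obtain ⟨G₁, N₁, hG₁⟩ := r.exists_eval_eq g.den
  obtain ⟨G₂, N₂, hG₂⟩ := r.exists_eval_eq Δ''
  obtain ⟨G₃, N₃, hG₃⟩ := g.exists_eval_eq r.den
  have hall : ∀ y ∈ V.discriminantVariety, eval y r.den ≠ 0 → eval (r.app y) Δ'' = 0 := by
    -- The factors other than `G₂` vanish at the non-generic points. None of them is divisible by
    -- `Δ`, so `Δ` divides `G₂`, the cleared form of `Δ'' ∘ r`.
    have hdvd : V.discriminantPolynomial ∣
        r.den * (G₁ * (pderiv i V.discriminantPolynomial * G₂)) := by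
      rw [dvd_iff_eval_eq_zero hΔ]
      intro y hy
      simp only [map_mul, mul_eq_zero]
      by_contra! h
      obtain ⟨h1, h2, h3, h4⟩ := h
      rw [hG₁ y h1] at h2
      rw [hG₂ y h1] at h4
      exact h4 (by rw [hgen y hy h1 (right_ne_zero_of_mul h2) h3, mul_zero])
    have hG₁' : ¬ V.discriminantPolynomial ∣ G₁ := by
      intro h
      have h0 := (dvd_iff_eval_eq_zero hΔ _).mp h y₁ hy₁
      rw [hG₁ y₁ hy₁d] at h0
      exact mul_ne_zero (pow_ne_zero _ hy₁d) hy₁g h0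
    have h1 := (hΔ.prime.dvd_or_dvd hdvd).resolve_left hp0
    have h2 := (hΔ.prime.dvd_or_dvd h1).resolve_left hG₁'
    have h3 := (hΔ.prime.dvd_or_dvd h2).resolve_left hi
    intro y hy hyd
    have h0 := (dvd_iff_eval_eq_zero hΔ _).mp h3 y hy
    rw [hG₂ y hyd] at h0
    exact (mul_eq_zero.mp h0).resolve_left (pow_ne_zero _ hyd)
  -- Where both maps are defined, a point of `C'` is `r` of its image under `g`; primality of `Δ'`
  -- covers the remaining points.
  have hdvd : Δ' ∣ g.den * (G₃ * Δ'') := by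
    rw [dvd_iff_eval_eq_zero hΔ']
    intro t ht
    simp only [map_mul, mul_eq_zero]
    by_contra! h
    obtain ⟨h1, h2, h3⟩ := h
    rw [hG₃ t h1] at h2
    have h4 := right_ne_zero_of_mul h2
    have h5 := hall (g.app t) (hgmap t ht h1) h4
    rw [hrg t ht h1 h4] at h5
    exact h3 h5
  have hg : ¬ Δ' ∣ g.den := fun h => ht₀d ((dvd_iff_eval_eq_zero hΔ' _).mp h t₀ ht₀)
  have hG₃' : ¬ Δ' ∣ G₃ := by
    intro h
    have h0 := (dvd_iff_eval_eq_zero hΔ' _).mp h t₁ ht₁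
    rw [hG₃ t₁ ht₁g] at h0
    exact mul_ne_zero (pow_ne_zero _ ht₁g) ht₁d h0
  have h1 := (hΔ'.prime.dvd_or_dvd hdvd).resolve_left hg
  have h2 := (hΔ'.prime.dvd_or_dvd h1).resolve_left hG₃'
  exact (dvd_iff_eval_eq_zero hΔ' _).mp h2

end Main

theorem theorem3p3 {H E : Type*}
    [NormedAddCommGroup H] [InnerProductSpace ℂ H] [CompleteSpace H]
    [NormedAddCommGroup E] [InnerProductSpace ℂ E] [FiniteDimensional ℂ E] [CompleteSpace E]
    (V : VesselData H E) (hV : V.IsVessel)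
    (hΔ : Irreducible V.discriminantPolynomial)
    (p : Fin 3 → MvPolynomial (Fin 2) ℝ)
    (hp : IsUnit (polyOp (p 0) V.A₁ V.A₂))
    (Δ' : MvPolynomial (Fin 2) ℂ) (hΔ' : Irreducible Δ')
    (hr : (realRationalMap p).IsBirationalIso V.discriminantVariety (planeCurve Δ')) :
    Nonempty (BezoutChoice p) ∧
      ∀ β : BezoutChoice p,
        (V.reducedTransform p β).IsVessel ∧
          planeCurve Δ' ⊆ (V.reducedTransform p β).discriminantVariety :=
  ⟨nonempty_bezoutChoice p, fun β => ⟨hV.reducedTransform p hp β,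
    hV.planeCurve_subset_discriminantVariety hΔ β hΔ' hr⟩⟩
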